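/- Let $E\subset\mathbb R^2$ be (the open region bounded by) a simple, not necessarily convex, quadrilateral with diameter $h_E$, counterclockwise ordered vertices $V_1,\dots,V_4$, and edges $e_j=[V_j,V_{j+1}]$ ($V_5=V_1$) with outward unit normals $n_j$. Assume that for some $\gamma>0$ the set $E$ is star-shaped with respect to a ball of radius at least $\gamma h_E$, and $|e_j|\ge\gamma h_E$ for all $j$. Let $$\Sigma_h(E)=\{\tau\in H(\mathrm{div};E):\ \tau=\nabla v \text{ for some } v\in H^1(E),\ \ \tau\cdot n_j \text{ is constant on } e_j \text{ for each } j,\ \ \mathrm{div}\,\tau \text{ is constant on } E\},$$ let $RT_0(E)=\{x\mapsto a+c\,x:\ a\in\mathbb R^2,\ c\in\mathbb R\}$, and let $(P_0(E))^2$ be the space of constant vector fields on $E$. Then: 1. There is exactly one $\theta\in\Sigma_h(E)$ with $\theta\cdot n_j=(-1)^j/|e_j|$ on $e_j$ for $j=1,\dots,4$, and the hourglass space $HG(E)=\mathrm{span}(\theta)$ has dimension one. 2. $\Sigma_h(E)=RT_0(E)\oplus HG(E)$. 3. The divergence-free subspace satisfies $\{\tau\in\Sigma_h(E):\ \mathrm{div}\,\tau=0\}=(P_0(E))^2\oplus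 HG(E)$, and this decomposition is orthogonal in $L^2(E)^2$. -/

import Mathlib

open MeasureTheory Set
open scoped ContDiff

noncomputable section

/-- The Euclidean plane. -/
abbrev Plane : Type := EuclideanSpace ℝ (Fin 2)

/-! ### Weak derivatives -/

/-- `φ ∈ C_c^∞(U)`. -/
def IsTestFunction (U : Set Plane) (φ : Plane → ℝ) : Prop :=
  ContDiff ℝ ∞ φ ∧ HasCompactSupport φ ∧ tsupport φ ⊆ U

/-- `g = ∇v` on `U` in the sense of distributions. -/
def HasWeakGradient (U : Set Plane) (v : Plane → ℝ) (g : Plane → Plane) : Prop :=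
  ∀ φ : Plane → ℝ, IsTestFunction U φ →
    ∫ x in U, v x • gradient φ x = -∫ x in U, φ x • g x

/-- `d = div τ` on `U` in the sense of distributions. -/
def HasWeakDivergence (U : Set Plane) (τ : Plane → Plane) (d : Plane → ℝ) : Prop :=
  ∀ φ : Plane → ℝ, IsTestFunction U φ →
    ∫ x in U, inner ℝ (τ x) (gradient φ x) = -∫ x in U, d x * φ x

/-- `v ∈ H¹(U)`. -/
def MemH1 (U : Set Plane) (v : Plane → ℝ) : Prop :=
  MemLp v 2 (volume.restrict U) ∧
    ∃ g : Plane → Plane, MemLp g 2 (volume.restrict U) ∧ HasWeakGradient U v g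

/-- `τ ∈ H(div; U)`. -/
def MemHDiv (U : Set Plane) (τ : Plane → Plane) : Prop :=
  MemLp τ 2 (volume.restrict U) ∧
    ∃ d : Plane → ℝ, MemLp d 2 (volume.restrict U) ∧ HasWeakDivergence U τ d

/-- `L²(U)²`, as a real Hilbert space. -/
abbrev L2Field (U : Set Plane) : Type := Lp Plane 2 (volume.restrict U)

/-! ### Quadrilaterals -/

/-- A (not necessarily convex) quadrilateral: four vertices, in counterclockwise order, joined
cyclically by edges that form a simple closed polygonal line, and the open region `E` which that
line bounds. The edge number `j` joins vertex `j` to vertex `j + 1`, cyclically. -/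
structure Quadrilateral where
  vertex : Fin 4 → Plane
  E : Set Plane
  vertex_injective : Function.Injective vertex
  adjacent_edges : ∀ j : Fin 4,
    segment ℝ (vertex j) (vertex (j + 1)) ∩ segment ℝ (vertex (j + 1)) (vertex (j + 2))
      = {vertex (j + 1)}
  opposite_edges : ∀ j : Fin 4,
    Disjoint (segment ℝ (vertex j) (vertex (j + 1)))
      (segment ℝ (vertex (j + 2)) (vertex (j + 3)))
  /-- counterclockwise order: the signed area (shoelace formula) is positive -/
  counterclockwise :
    0 < ∑ j : Fin 4, (vertex j 0 * vertex (j + 1) 1 - vertex (j + 1) 0 * vertex j 1)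
  isOpen_E : IsOpen E
  isConnected_E : IsConnected E
  isBounded_E : Bornology.IsBounded E
  frontier_E : frontier E = ⋃ j : Fin 4, segment ℝ (vertex j) (vertex (j + 1))

namespace Quadrilateral

/-- `|e_j|` -/
def edgeLength (Q : Quadrilateral) (j : Fin 4) : ℝ :=
  dist (Q.vertex j) (Q.vertex (j + 1))

/-- The diameter `h_E`. -/
def diameter (Q : Quadrilateral) : ℝ := Metric.diam Q.E

/-- The mesh assumptions with parameter `γ`: `E` is star-shaped with respect to (every point of)
a ball of radius at least `γ h_E`, and every edge has length at least `γ h_E`. -/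
structure ShapeRegular (Q : Quadrilateral) (γ : ℝ) : Prop where
  starShaped : ∃ (x₀ : Plane) (r : ℝ), γ * Q.diameter ≤ r ∧
    Metric.ball x₀ r ⊆ Q.E ∧ ∀ y ∈ Metric.ball x₀ r, StarConvex ℝ y Q.E
  edge_length : ∀ j : Fin 4, γ * Q.diameter ≤ Q.edgeLength j

/-- The integral of `f` over the edge `e_j` with respect to arc length. -/
def edgeIntegral (Q : Quadrilateral) (j : Fin 4) (f : Plane → ℝ) : ℝ :=
  Q.edgeLength j * ∫ t in (0 : ℝ)..1, f (AffineMap.lineMap (Q.vertex j) (Q.vertex (j + 1)) t)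

/-- The normal trace `τ · n` (`n` the outward unit normal) of the field `τ ∈ H(div; E)` is the
function that equals `g j` on the edge `e_j`. As usual, the normal trace of a field in `H(div; E)`
is the functional on the traces of functions on `E` that Green's formula defines:
`∫_E τ · ∇φ + ∫_E (div τ) φ = ∫_{∂E} (τ · n) φ`. -/
def HasNormalTrace (Q : Quadrilateral) (τ : Plane → Plane) (g : Fin 4 → Plane → ℝ) : Prop :=
  ∃ d : Plane → ℝ, MemLp d 2 (volume.restrict Q.E) ∧ HasWeakDivergence Q.E τ d ∧
    ∀ φ : Plane → ℝ, IsTestFunction univ φ →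
      (∫ x in Q.E, inner ℝ (τ x) (gradient φ x)) + ∫ x in Q.E, d x * φ x
        = ∑ j : Fin 4, Q.edgeIntegral j (fun x => g j x * φ x)

/-- Membership in the local virtual element space `Σ_h(E)`: `τ ∈ H(div; E)`, `τ = ∇v` for some
`v ∈ H¹(E)`, `τ · n_e ∈ P_0(e)` on every edge `e`, and `div τ ∈ P_0(E)`. -/
structure MemVEM (Q : Quadrilateral) (τ : Plane → Plane) : Prop where
  memHDiv : MemHDiv Q.E τ
  potential : ∃ v : Plane → ℝ, MemH1 Q.E v ∧ HasWeakGradient Q.E v τ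
  normalTrace : ∃ c : Fin 4 → ℝ, Q.HasNormalTrace τ (fun j _ => c j)
  divergence : ∃ δ : ℝ, HasWeakDivergence Q.E τ (fun _ => δ)

end Quadrilateral

/-! ### Linearity of the weak notions, needed for `Σ_h(E)` to be a subspace -/

theorem IsTestFunction.memLp {U : Set Plane} {φ : Plane → ℝ} (h : IsTestFunction U φ)
    (S : Set Plane) : MemLp φ 2 (volume.restrict S) :=
  (h.1.continuous.memLp_of_hasCompactSupport h.2.1).restrict S

theorem IsTestFunction.memLp_gradient {U : Set Plane} {φ : Plane → ℝ} (h : IsTestFunction U φ)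
    (S : Set Plane) : MemLp (gradient φ) 2 (volume.restrict S) := by
  have hc : Continuous (gradient φ) :=
    (InnerProductSpace.toDual ℝ Plane).symm.continuous.comp
      (h.1.continuous_fderiv (by simp))
  have hs : HasCompactSupport (gradient φ) :=
    (h.2.1.fderiv (𝕜 := ℝ)).comp_left (g := (InnerProductSpace.toDual ℝ Plane).symm) (map_zero _)
  exact (hc.memLp_of_hasCompactSupport hs).restrict S

theorem integrable_smul_of_memLp {U : Set Plane} {v : Plane → ℝ} {g : Plane → Plane}
    (hv : MemLp v 2 (volume.restrict U)) (hg : MemLp g 2 (volume.restrict U)) :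
    Integrable (fun x => v x • g x) (volume.restrict U) :=
  memLp_one_iff_integrable.1 (hg.smul hv)

theorem integrable_inner_of_memLp {U : Set Plane} {f g : Plane → Plane}
    (hf : MemLp f 2 (volume.restrict U)) (hg : MemLp g 2 (volume.restrict U)) :
    Integrable (fun x => inner ℝ (f x) (g x)) (volume.restrict U) := by
  refine (L2.integrable_inner (𝕜 := ℝ) (hf.toLp f) (hg.toLp g)).congr ?_
  filter_upwards [hf.coeFn_toLp, hg.coeFn_toLp] with x h₁ h₂
  rw [h₁, h₂]

theorem integrable_mul_of_memLp {U : Set Plane} {f g : Plane → ℝ}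
    (hf : MemLp f 2 (volume.restrict U)) (hg : MemLp g 2 (volume.restrict U)) :
    Integrable (fun x => f x * g x) (volume.restrict U) :=
  hf.integrable_mul hg

theorem HasWeakGradient.add {U : Set Plane} {v w : Plane → ℝ} {f g : Plane → Plane}
    (hv : MemLp v 2 (volume.restrict U)) (hw : MemLp w 2 (volume.restrict U))
    (hf : MemLp f 2 (volume.restrict U)) (hg : MemLp g 2 (volume.restrict U))
    (h₁ : HasWeakGradient U v f) (h₂ : HasWeakGradient U w g) :
    HasWeakGradient U (v + w) (f + g) := by
  intro φ hφ
  have a := (hφ.memLp_gradient U)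
  have b := (hφ.memLp U)
  simp only [Pi.add_apply, add_smul, smul_add]
  rw [integral_add (integrable_smul_of_memLp hv a) (integrable_smul_of_memLp hw a),
    integral_add (integrable_smul_of_memLp b hf) (integrable_smul_of_memLp b hg), h₁ φ hφ, h₂ φ hφ, neg_add]

theorem HasWeakGradient.const_smul {U : Set Plane} {v : Plane → ℝ} {f : Plane → Plane} (a : ℝ)
    (h : HasWeakGradient U v f) : HasWeakGradient U (a • v) (a • f) := by
  intro φ hφ
  simp only [Pi.smul_apply, smul_eq_mul, mul_smul, smul_comm _ a]
  rw [integral_smul, integral_smul, h φ hφ, smul_neg]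

theorem HasWeakDivergence.add {U : Set Plane} {σ τ : Plane → Plane} {d e : Plane → ℝ}
    (hσ : MemLp σ 2 (volume.restrict U)) (hτ : MemLp τ 2 (volume.restrict U))
    (hd : MemLp d 2 (volume.restrict U)) (he : MemLp e 2 (volume.restrict U))
    (h₁ : HasWeakDivergence U σ d) (h₂ : HasWeakDivergence U τ e) :
    HasWeakDivergence U (σ + τ) (d + e) := by
  intro φ hφ
  have a := (hφ.memLp_gradient U)
  have b := (hφ.memLp U)
  simp only [Pi.add_apply, inner_add_left, add_mul]
  rw [integral_add (integrable_inner_of_memLp hσ a) (integrable_inner_of_memLp hτ a),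
    integral_add (integrable_mul_of_memLp hd b) (integrable_mul_of_memLp he b), h₁ φ hφ, h₂ φ hφ, neg_add]

theorem HasWeakDivergence.const_smul {U : Set Plane} {τ : Plane → Plane} {d : Plane → ℝ} (a : ℝ)
    (h : HasWeakDivergence U τ d) : HasWeakDivergence U (a • τ) (a • d) := by
  intro φ hφ
  simp only [Pi.smul_apply, smul_eq_mul, real_inner_smul_left, mul_assoc]
  rw [integral_const_mul, integral_const_mul, h φ hφ, mul_neg]

theorem HasWeakGradient.congr {U : Set Plane} {v w : Plane → ℝ} {f g : Plane → Plane}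
    (hv : v =ᵐ[volume.restrict U] w) (hf : f =ᵐ[volume.restrict U] g)
    (h : HasWeakGradient U v f) : HasWeakGradient U w g := by
  intro φ hφ
  have e1 : ∫ x in U, v x • gradient φ x = ∫ x in U, w x • gradient φ x :=
    integral_congr_ae (by filter_upwards [hv] with x hx; rw [hx])
  have e2 : ∫ x in U, φ x • f x = ∫ x in U, φ x • g x :=
    integral_congr_ae (by filter_upwards [hf] with x hx; rw [hx])
  rw [← e1, ← e2, h φ hφ]

theorem integral_inner_congr {U : Set Plane} {σ τ ψ : Plane → Plane}
    (h : σ =ᵐ[volume.restrict U] τ) :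
    ∫ x in U, inner ℝ (σ x) (ψ x) = ∫ x in U, inner ℝ (τ x) (ψ x) :=
  integral_congr_ae (by filter_upwards [h] with x hx; rw [hx])

theorem HasWeakDivergence.congr {U : Set Plane} {σ τ : Plane → Plane} {d : Plane → ℝ}
    (hσ : σ =ᵐ[volume.restrict U] τ) (h : HasWeakDivergence U σ d) :
    HasWeakDivergence U τ d := by
  intro φ hφ
  rw [← integral_inner_congr hσ, h φ hφ]

namespace Quadrilateral

variable (Q : Quadrilateral)

theorem memLp_const (c : ℝ) : MemLp (fun _ : Plane => c) 2 (volume.restrict Q.E) :=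
  haveI : IsFiniteMeasure (volume.restrict Q.E) :=
    ⟨by simpa using Q.isBounded_E.measure_lt_top⟩
  MeasureTheory.memLp_const c

theorem edgeIntegral_const_mul (j : Fin 4) (c : ℝ) (φ : Plane → ℝ) :
    Q.edgeIntegral j (fun x => c * φ x) = c * Q.edgeIntegral j φ := by
  simp only [edgeIntegral, intervalIntegral.integral_const_mul]
  ring

variable {Q}

theorem HasNormalTrace.add {σ τ : Plane → Plane} {b c : Fin 4 → ℝ}
    (hσ : MemLp σ 2 (volume.restrict Q.E)) (hτ : MemLp τ 2 (volume.restrict Q.E))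
    (h₁ : Q.HasNormalTrace σ (fun j _ => b j)) (h₂ : Q.HasNormalTrace τ (fun j _ => c j)) :
    Q.HasNormalTrace (σ + τ) (fun j _ => b j + c j) := by
  obtain ⟨d, hd, hd', h₁⟩ := h₁
  obtain ⟨e, he, he', h₂⟩ := h₂
  refine ⟨d + e, hd.add he, hd'.add hσ hτ hd he he', fun φ hφ => ?_⟩
  have p := (hφ.memLp_gradient Q.E)
  have q := (hφ.memLp Q.E)
  have e₁ := h₁ φ hφ
  have e₂ := h₂ φ hφ
  simp only [edgeIntegral_const_mul] at e₁ e₂ ⊢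
  simp only [Pi.add_apply, inner_add_left, add_mul, Finset.sum_add_distrib]
  rw [integral_add (integrable_inner_of_memLp hσ p) (integrable_inner_of_memLp hτ p),
    integral_add (integrable_mul_of_memLp hd q) (integrable_mul_of_memLp he q), ← e₁, ← e₂]
  ring

theorem HasNormalTrace.const_smul {τ : Plane → Plane} {c : Fin 4 → ℝ} (a : ℝ)
    (h : Q.HasNormalTrace τ (fun j _ => c j)) :
    Q.HasNormalTrace (a • τ) (fun j _ => a * c j) := by
  obtain ⟨d, hd, hd', h⟩ := h
  refine ⟨a • d, hd.const_smul a, hd'.const_smul a, fun φ hφ => ?_⟩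
  have e := h φ hφ
  simp only [edgeIntegral_const_mul] at e ⊢
  simp only [Pi.smul_apply, smul_eq_mul, real_inner_smul_left, mul_assoc]
  rw [integral_const_mul, integral_const_mul, ← mul_add, e, Finset.mul_sum]

theorem HasNormalTrace.congr {σ τ : Plane → Plane} {g : Fin 4 → Plane → ℝ}
    (hσ : σ =ᵐ[volume.restrict Q.E] τ) (h : Q.HasNormalTrace σ g) : Q.HasNormalTrace τ g := by
  obtain ⟨d, hd, hd', h⟩ := h
  refine ⟨d, hd, hd'.congr hσ, fun φ hφ => ?_⟩
  rw [← integral_inner_congr hσ, h φ hφ]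

theorem MemVEM.add {σ τ : Plane → Plane} (h₁ : Q.MemVEM σ) (h₂ : Q.MemVEM τ) :
    Q.MemVEM (σ + τ) := by
  have hσ := h₁.memHDiv.1
  have hτ := h₂.memHDiv.1
  obtain ⟨d, hd, hd'⟩ := h₁.memHDiv.2
  obtain ⟨e, he, he'⟩ := h₂.memHDiv.2
  obtain ⟨v, hv, hv'⟩ := h₁.potential
  obtain ⟨w, hw, hw'⟩ := h₂.potential
  obtain ⟨b, hb⟩ := h₁.normalTrace
  obtain ⟨c, hc⟩ := h₂.normalTrace
  obtain ⟨δ, hδ⟩ := h₁.divergence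
  obtain ⟨ε, hε⟩ := h₂.divergence
  have hg := hv'.add hv.1 hw.1 hσ hτ hw'
  exact ⟨⟨hσ.add hτ, d + e, hd.add he, hd'.add hσ hτ hd he he'⟩,
    ⟨v + w, ⟨hv.1.add hw.1, σ + τ, hσ.add hτ, hg⟩, hg⟩,
    ⟨_, hb.add hσ hτ hc⟩,
    ⟨δ + ε, hδ.add hσ hτ (Q.memLp_const δ) (Q.memLp_const ε) hε⟩⟩

theorem MemVEM.const_smul {τ : Plane → Plane} (a : ℝ) (h : Q.MemVEM τ) : Q.MemVEM (a • τ) := by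
  have hτ := h.memHDiv.1
  obtain ⟨d, hd, hd'⟩ := h.memHDiv.2
  obtain ⟨v, hv, hv'⟩ := h.potential
  obtain ⟨c, hc⟩ := h.normalTrace
  obtain ⟨δ, hδ⟩ := h.divergence
  have hg := hv'.const_smul a
  exact ⟨⟨hτ.const_smul a, a • d, hd.const_smul a, hd'.const_smul a⟩,
    ⟨a • v, ⟨hv.1.const_smul a, a • τ, hτ.const_smul a, hg⟩, hg⟩,
    ⟨_, hc.const_smul a⟩, ⟨a * δ, hδ.const_smul a⟩⟩

theorem MemVEM.congr {σ τ : Plane → Plane} (hσ : σ =ᵐ[volume.restrict Q.E] τ)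
    (h : Q.MemVEM σ) : Q.MemVEM τ := by
  obtain ⟨d, hd, hd'⟩ := h.memHDiv.2
  obtain ⟨v, hv, hv'⟩ := h.potential
  obtain ⟨c, hc⟩ := h.normalTrace
  obtain ⟨δ, hδ⟩ := h.divergence
  exact ⟨⟨h.memHDiv.1.ae_eq hσ, d, hd, hd'.congr hσ⟩,
    ⟨v, hv, hv'.congr Filter.EventuallyEq.rfl hσ⟩, ⟨c, hc.congr hσ⟩, ⟨δ, hδ.congr hσ⟩⟩

theorem MemVEM.zero : Q.MemVEM (0 : Plane → Plane) := by
  have hg : HasWeakGradient Q.E 0 0 := fun φ _ => by simp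
  have hd : HasWeakDivergence Q.E 0 (fun _ => 0) := fun φ _ => by simp
  exact ⟨⟨MemLp.zero, _, MemLp.zero', hd⟩, ⟨0, ⟨MemLp.zero, 0, MemLp.zero, hg⟩, hg⟩,
    ⟨0, _, MemLp.zero', hd, fun φ _ => by simp [edgeIntegral]⟩, ⟨0, hd⟩⟩

variable (Q)

/-! ### The spaces -/

/-- The local virtual element space `Σ_h(E)`, a subspace of `L²(E)²`. -/
def vemSpace : Submodule ℝ (L2Field Q.E) where
  carrier := {τ | Q.MemVEM τ}
  add_mem' {σ τ} hσ hτ := (MemVEM.add hσ hτ).congr (Lp.coeFn_add σ τ).symm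
  zero_mem' := MemVEM.zero.congr (Lp.coeFn_zero Plane 2 (volume.restrict Q.E)).symm
  smul_mem' a τ hτ := (MemVEM.const_smul a hτ).congr (Lp.coeFn_smul a τ).symm

/-- The divergence-free subspace of `Σ_h(E)`. -/
def vemDivFree : Submodule ℝ (L2Field Q.E) where
  carrier := {τ | τ ∈ Q.vemSpace ∧ HasWeakDivergence Q.E τ (fun _ => 0)}
  add_mem' {σ τ} hσ hτ := ⟨add_mem hσ.1 hτ.1, by
    have h := hσ.2.add (Lp.memLp σ) (Lp.memLp τ) (Q.memLp_const 0) (Q.memLp_const 0) hτ.2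
    have h' := h.congr (Lp.coeFn_add σ τ).symm
    intro φ hφ
    simpa using h' φ hφ⟩
  zero_mem' := ⟨zero_mem _, HasWeakDivergence.congr (σ := 0)
    (Lp.coeFn_zero Plane 2 (volume.restrict Q.E)).symm (fun φ _ => by simp)⟩
  smul_mem' a τ hτ := ⟨Submodule.smul_mem _ a hτ.1, by
    have h := (hτ.2.const_smul a).congr (Lp.coeFn_smul a τ).symm
    intro φ hφ
    simpa using h φ hφ⟩

/-- The constant vector fields `(P_0(E))²`. -/
def constFields : Submodule ℝ (L2Field Q.E) where
  carrier := {τ | ∃ a : Plane, τ =ᵐ[volume.restrict Q.E] fun _ => a}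
  add_mem' {σ τ} := by
    rintro ⟨a, ha⟩ ⟨b, hb⟩
    refine ⟨a + b, ?_⟩
    filter_upwards [ha, hb, Lp.coeFn_add σ τ] with x h₁ h₂ h₃
    rw [h₃, Pi.add_apply, h₁, h₂]
  zero_mem' := ⟨0, Lp.coeFn_zero Plane 2 (volume.restrict Q.E)⟩
  smul_mem' s τ := by
    rintro ⟨a, ha⟩
    refine ⟨s • a, ?_⟩
    filter_upwards [ha, Lp.coeFn_smul s τ] with x h₁ h₃
    rw [h₃, Pi.smul_apply, h₁]

/-- The Raviart-Thomas space `RT_0(E)`: the fields `x ↦ a + c x` with `a ∈ ℝ²`, `c ∈ ℝ`. -/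
def raviartThomas : Submodule ℝ (L2Field Q.E) where
  carrier := {τ | ∃ (a : Plane) (c : ℝ), τ =ᵐ[volume.restrict Q.E] fun x => a + c • x}
  add_mem' {σ τ} := by
    rintro ⟨a, c, ha⟩ ⟨b, d, hb⟩
    refine ⟨a + b, c + d, ?_⟩
    filter_upwards [ha, hb, Lp.coeFn_add σ τ] with x h₁ h₂ h₃
    rw [h₃, Pi.add_apply, h₁, h₂]
    module
  zero_mem' := ⟨0, 0, by
    filter_upwards [Lp.coeFn_zero Plane 2 (volume.restrict Q.E)] with x h
    rw [h]
    simp⟩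
  smul_mem' s τ := by
    rintro ⟨a, c, ha⟩
    refine ⟨s • a, s * c, ?_⟩
    filter_upwards [ha, Lp.coeFn_smul s τ] with x h₁ h₃
    rw [h₃, Pi.smul_apply, h₁]
    module

/-- `θ` is the hourglass function of `E`: `θ ∈ Σ_h(E)` and `θ · n_j = (-1)^j / |e_j|` on the edge
number `j`, where the edges are counted `1, …, 4`. -/
def IsHourglass (θ : L2Field Q.E) : Prop :=
  θ ∈ Q.vemSpace ∧
    Q.HasNormalTrace θ (fun j _ => (-1 : ℝ) ^ ((j : ℕ) + 1) / Q.edgeLength j)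

/-- The hourglass space `HG(E)`, spanned by the hourglass function. -/
def hourglassSpace : Submodule ℝ (L2Field Q.E) :=
  Submodule.span ℝ {θ | Q.IsHourglass θ}

end Quadrilateral

end

noncomputable section

/-! ### Geometry of star-shaped quadrilaterals -/

/-! A field of `Σ_h(E)` is determined by its four edge fluxes, and every flux vector is attained by
a Raviart-Thomas field plus a multiple of `θ`; the rest follows from Green's formula.

Uniqueness (`eq_zero_of_normalTrace`): zero edge fluxes force zero divergence, so Green's formula
makes the field orthogonal to all gradients of smooth functions. Being a weak gradient, the field
also lies in the `L²` closure of these gradients (`mem_closure_gradSpace`), hence it is zero.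

Existence (`exists_isHourglass`): star-shapedness cuts `E` into four triangles with apex at the star
centre. A field constant on each triangle, with matching fluxes across the spokes, has the
alternating edge fluxes. Its orthogonal projection onto the closure of the smooth gradients
satisfies the same Green formula, and a Poincaré inequality supplies a potential for it
(`exists_potential`).

Decompositions: Raviart-Thomas fields and alternating fluxes together reach all flux vectors
(`exists_flux_eq`). The alternating sum of the edge midpoints vanishes, so `θ` is orthogonal to
constants. Testing with the product of the linear forms given by the diagonals shows `θ ≠ 0`. Since
`HG(E)` is divergence-free and divergence-free Raviart-Thomas fields are constant, orthogonality
makes both sums direct. -/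

/-- The determinant of two plane vectors. -/
def cross2 (a b : Plane) : ℝ := a 0 * b 1 - b 0 * a 1

theorem plane_ext {a b : Plane} (h0 : a 0 = b 0) (h1 : a 1 = b 1) : a = b := by
  ext i; fin_cases i
  · exact h0
  · exact h1

/-- Cramer's rule, kept free of division. -/
theorem cross2_smul_eq (e u w : Plane) :
    cross2 u w • e = cross2 e w • u + cross2 u e • w := by
  apply plane_ext <;> simp [cross2] <;> ring

/-- `E` is star-shaped with respect to each point of a nondegenerate ball contained in it. -/
structure IsStarBall (E : Set Plane) (x₀ : Plane) (r : ℝ) : Prop where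
  pos : 0 < r
  ball_subset : Metric.ball x₀ r ⊆ E
  star : ∀ y ∈ Metric.ball x₀ r, StarConvex ℝ y E

/-! ### Rays from a star centre -/

namespace IsStarBall

variable {E : Set Plane} {x₀ : Plane} {r : ℝ}

theorem center_mem_ball (h : IsStarBall E x₀ r) : x₀ ∈ Metric.ball x₀ r :=
  Metric.mem_ball_self h.pos

/-- Replace `p` by a nearby `p' ∈ E` and move `y` inside the ball so that the intermediate point
stays the same; star-shapedness applies to the new pair. -/
theorem add_smul_mem (h : IsStarBall E x₀ r) {p y : Plane} (hp : p ∈ closure E)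
    (hy : y ∈ Metric.ball x₀ r) {s : ℝ} (hs0 : 0 ≤ s) (hs1 : s < 1) :
    y + s • (p - y) ∈ E := by
  have hd : 0 < r - dist y x₀ := by rw [Metric.mem_ball] at hy; linarith
  have hs : 0 < 1 - s := by linarith
  -- Moving `p` by `p - p'` displaces `y` by `s / (1 - s)` times as much; this tolerance keeps `y`
  -- in the ball.
  obtain ⟨p', hp', hpp⟩ := Metric.mem_closure_iff.1 hp ((r - dist y x₀) * (1 - s))
    (mul_pos hd hs)
  have hy' : y + (s / (1 - s)) • (p - p') ∈ Metric.ball x₀ r := by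
    rw [Metric.mem_ball]
    calc dist (y + (s / (1 - s)) • (p - p')) x₀
        ≤ dist (y + (s / (1 - s)) • (p - p')) y + dist y x₀ := dist_triangle _ _ _
      _ = s / (1 - s) * dist p p' + dist y x₀ := by
          rw [dist_eq_norm, add_sub_cancel_left, norm_smul, Real.norm_of_nonneg (by positivity),
            dist_eq_norm p p']
      _ ≤ s / (1 - s) * ((r - dist y x₀) * (1 - s)) + dist y x₀ := by gcongr
      _ = s * (r - dist y x₀) + dist y x₀ := by field_simp
      _ < r := by nlinarith
  have := h.star _ hy' hp' hs.le hs0 (by ring)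
  convert this using 1
  rw [smul_add, smul_smul, mul_div_cancel₀ _ hs.ne']
  module

/-- A ray from the centre meets the frontier at most once: of two such points the nearer would lie
in `E` by `add_smul_mem`. -/
theorem eq_of_ray (h : IsStarBall E x₀ r) (hE : IsOpen E) {p q : Plane} (hp : p ∈ frontier E)
    (hq : q ∈ frontier E) {s : ℝ} (hs : 0 ≤ s) (hpq : q - x₀ = s • (p - x₀)) : p = q := by
  rw [hE.frontier_eq] at hp hq
  rcases lt_trichotomy s 1 with h1 | h1 | h1
  · exact absurd (by simpa [← hpq] using h.add_smul_mem hp.1 h.center_mem_ball hs h1) hq.2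
  · rw [h1, one_smul] at hpq
    exact (sub_left_injective hpq).symm
  · have hs0 : s ≠ 0 := by linarith
    have := h.add_smul_mem hq.1 h.center_mem_ball (inv_nonneg.2 hs) (inv_lt_one_of_one_lt₀ h1)
    rw [hpq, smul_smul, inv_mul_cancel₀ hs0, one_smul, add_sub_cancel] at this
    exact absurd this hp.2

/-- The half-line beyond `x` is connected, starts in `E` and leaves it by boundedness, so it crosses
the frontier. -/
theorem _root_.exists_ray_exit (hE : IsOpen E) (hb : Bornology.IsBounded E)
    {x : Plane} (hx : x ∈ E) (hne : x ≠ x₀) :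
    ∃ s : ℝ, 1 < s ∧ x₀ + s • (x - x₀) ∈ frontier E := by
  have hc : IsPreconnected ((fun s : ℝ => x₀ + s • (x - x₀)) '' Ici 1) :=
    isPreconnected_Ici.image _ (by fun_prop)
  obtain ⟨R, hR⟩ := hb.subset_closedBall x₀
  have hpos : 0 < ‖x - x₀‖ := norm_pos_iff.2 (sub_ne_zero.2 hne)
  have h1 : (((fun s : ℝ => x₀ + s • (x - x₀)) '' Ici 1) ∩ E).Nonempty :=
    ⟨x, ⟨1, by simp, by simp⟩, hx⟩
  have h2 : (((fun s : ℝ => x₀ + s • (x - x₀)) '' Ici 1) ∩ Eᶜ).Nonempty := by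
    refine ⟨_, ⟨max 1 ((|R| + 1) / ‖x - x₀‖), mem_Ici.2 (le_max_left _ _), rfl⟩, fun hmem => ?_⟩
    have := hR hmem
    rw [Metric.mem_closedBall, dist_eq_norm, add_sub_cancel_left, norm_smul, Real.norm_eq_abs,
      abs_of_pos (lt_of_lt_of_le one_pos (le_max_left _ _))] at this
    have h3 : (|R| + 1) / ‖x - x₀‖ * ‖x - x₀‖ ≤ R :=
      (mul_le_mul_of_nonneg_right (le_max_right _ _) hpos.le).trans this
    rw [div_mul_cancel₀ _ hpos.ne'] at h3
    linarith [le_abs_self R]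
  obtain ⟨_, ⟨s, hs, rfl⟩, hf⟩ : (((fun s : ℝ => x₀ + s • (x - x₀)) '' Ici 1) ∩
      frontier E).Nonempty := by
    by_contra hemp
    have hout : ∀ z ∈ (fun s : ℝ => x₀ + s • (x - x₀)) '' Ici 1, z ∉ E → z ∈ (closure E)ᶜ :=
      fun z hz hzE hzc => hemp ⟨z, hz, by rw [hE.frontier_eq]; exact ⟨hzc, hzE⟩⟩
    obtain ⟨z, hz, hzE⟩ := h2
    obtain ⟨y, -, hy1, hy2⟩ := hc E (closure E)ᶜ hE isClosed_closure.isOpen_compl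
      (fun z hz => or_iff_not_imp_left.2 (hout z hz)) h1 ⟨z, hz, hout z hz hzE⟩
    exact hy2 (subset_closure hy1)
  refine ⟨s, lt_of_le_of_ne hs ?_, hf⟩
  rintro rfl
  rw [hE.frontier_eq] at hf
  exact hf.2 (by simpa using hx)

end IsStarBall

/-- The open triangle with vertices `x₀`, `x₀ + u`, `x₀ + w`. -/
def openTriangle (x₀ u w : Plane) : Set Plane :=
  {x | ∃ a b : ℝ, 0 < a ∧ 0 < b ∧ a + b < 1 ∧ x = x₀ + (a • u + b • w)}

theorem volume_line (x₀ w : Plane) : volume {x : Plane | ∃ c : ℝ, x = x₀ + c • w} = 0 := by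
  refine measure_mono_null ?_ (Measure.addHaar_affineSubspace volume
    (AffineSubspace.mk' x₀ (Submodule.span ℝ {w})) ?_)
  · rintro x ⟨c, rfl⟩
    simp only [SetLike.mem_coe, AffineSubspace.mem_mk']
    simpa using Submodule.smul_mem _ c (Submodule.mem_span_singleton_self w)
  · intro htop
    have h1 : Submodule.span ℝ {w} = ⊤ := by
      rw [← AffineSubspace.direction_mk' x₀ (Submodule.span ℝ {w}), htop,
        AffineSubspace.direction_top]
    have h2 := finrank_span_le_card (R := ℝ) ({w} : Set Plane)
    rw [h1, finrank_top] at h2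
    simp at h2

namespace Quadrilateral

variable (Q : Quadrilateral) {x₀ : Plane} {r : ℝ}

theorem segment_subset_frontier (j : Fin 4) :
    segment ℝ (Q.vertex j) (Q.vertex (j + 1)) ⊆ frontier Q.E := by
  rw [Q.frontier_E]
  exact subset_iUnion (fun j => segment ℝ (Q.vertex j) (Q.vertex (j + 1))) j

theorem disjoint_frontier : Disjoint Q.E (frontier Q.E) := by
  rw [Q.isOpen_E.frontier_eq]; exact disjoint_sdiff_right

theorem vertex_mem_frontier (j : Fin 4) : Q.vertex j ∈ frontier Q.E :=
  Q.segment_subset_frontier j (left_mem_segment ℝ _ _)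

theorem vertex_succ_ne (j : Fin 4) : Q.vertex (j + 1) ≠ Q.vertex j := by
  intro h
  have hne : ∀ j : Fin 4, j + 1 ≠ j := by decide
  exact hne j (Q.vertex_injective h)

theorem diameter_pos : 0 < Q.diameter := by
  have hb := Q.isBounded_E
  rw [diameter, ← Metric.diam_closure]
  refine lt_of_lt_of_le (dist_pos.2 (Q.vertex_succ_ne 0))
    (Metric.dist_le_diam_of_mem hb.closure ?_ ?_) <;>
  exact frontier_subset_closure (Q.vertex_mem_frontier _)

theorem edgeLength_pos (j : Fin 4) : 0 < Q.edgeLength j :=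
  dist_pos.2 (Q.vertex_succ_ne j).symm

theorem ShapeRegular.exists_isStarBall {Q : Quadrilateral} {γ : ℝ} (hγ : 0 < γ)
    (hQ : Q.ShapeRegular γ) : ∃ (x₀ : Plane) (r : ℝ), IsStarBall Q.E x₀ r := by
  obtain ⟨x₀, r, h1, h2, h3⟩ := hQ.starShaped
  exact ⟨x₀, r, (mul_pos hγ Q.diameter_pos).trans_le h1, h2, h3⟩

/-! ### The vertices turn counterclockwise around the star centre -/

/-- Twice the signed area of the triangle spanned by `x₀` and the edge `e_j`. -/
def spokeDet (x₀ : Plane) (j : Fin 4) : ℝ :=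
  cross2 (Q.vertex j - x₀) (Q.vertex (j + 1) - x₀)

variable {Q}

/-- Radial projection from `x₀`: a point of the cone over a segment is rescaled to land on the
segment. -/
theorem combo_mem_segment {p q : Plane} {a b : ℝ} (ha : 0 ≤ a) (hb : 0 ≤ b) (hab : 0 < a + b)
    (x₀ : Plane) :
    x₀ + (a + b)⁻¹ • (a • (p - x₀) + b • (q - x₀)) ∈ segment ℝ p q := by
  refine ⟨a / (a + b), b / (a + b), by positivity, by positivity, by field_simp, ?_⟩
  have h1 : (a + b)⁻¹ * a + (a + b)⁻¹ * b = 1 := by field_simp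
  have : x₀ = ((a + b)⁻¹ * a + (a + b)⁻¹ * b) • x₀ := by rw [h1, one_smul]
  rw [div_eq_inv_mul, div_eq_inv_mul]
  nth_rw 1 [this]
  module

theorem eq_of_combo {u w : Plane} {a b : ℝ} (ha : a ≠ 0) (hab : a + b ≠ 0)
    (h : (a + b)⁻¹ • (a • u + b • w) = w) : u = w := by
  have h3 : a • u + b • w = (a + b) • w := by
    conv_rhs => rw [← h]
    rw [smul_smul, mul_inv_cancel₀ hab, one_smul]
  rw [add_smul, add_left_inj] at h3
  exact smul_right_injective _ ha h3

theorem vertex_ne_center (h : IsStarBall Q.E x₀ r) (j : Fin 4) : Q.vertex j ≠ x₀ := fun hx =>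
  Q.disjoint_frontier.le_bot ⟨h.ball_subset h.center_mem_ball, hx ▸ Q.vertex_mem_frontier j⟩

/-- If the edge were collinear with `x₀`, either its endpoints would share a ray, against
`eq_of_ray`, or the edge would pass through `x₀ ∈ E`. -/
theorem spokeDet_ne_zero (h : IsStarBall Q.E x₀ r) (j : Fin 4) : Q.spokeDet x₀ j ≠ 0 := by
  intro h0
  set u := Q.vertex j - x₀ with hu
  set w := Q.vertex (j + 1) - x₀ with hw
  have hune : u ≠ 0 := sub_ne_zero.2 (vertex_ne_center h j)
  have hn : u 0 ^ 2 + u 1 ^ 2 ≠ 0 := by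
    intro hn
    exact hune (plane_ext (by simp; nlinarith [sq_nonneg (u 0), sq_nonneg (u 1)])
      (by simp; nlinarith [sq_nonneg (u 0), sq_nonneg (u 1)]))
  have h0' : u 0 * w 1 - w 0 * u 1 = 0 := h0
  obtain ⟨c, hc⟩ : ∃ c : ℝ, w = c • u := by
    refine ⟨(u 0 * w 0 + u 1 * w 1) / (u 0 ^ 2 + u 1 ^ 2), plane_ext ?_ ?_⟩
    · simp; field_simp; linear_combination (-u 1) * h0'
    · simp; field_simp; linear_combination (u 0) * h0'
  rcases le_or_gt 0 c with hc0 | hc0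
  · exact Q.vertex_succ_ne j (h.eq_of_ray Q.isOpen_E (Q.vertex_mem_frontier j)
      (Q.vertex_mem_frontier (j + 1)) hc0 hc).symm
  · have hm := combo_mem_segment (p := Q.vertex j) (q := Q.vertex (j + 1)) (a := -c) (b := 1)
      (by linarith) zero_le_one (by linarith) x₀
    rw [← hu, ← hw, hc] at hm
    have : x₀ + (-c + 1)⁻¹ • (-c • u + (1 : ℝ) • c • u) = x₀ := by
      simp
    rw [this] at hm
    exact Q.disjoint_frontier.le_bot ⟨h.ball_subset h.center_mem_ball,
      Q.segment_subset_frontier j hm⟩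

/-- With opposite signs the boundary would fold back at vertex `j + 1`: a ray close to that spoke
would meet both adjacent edges, by `eq_of_ray` in one common point, which is not the vertex. -/
theorem spokeDet_mul_succ_pos (h : IsStarBall Q.E x₀ r) (j : Fin 4) :
    0 < Q.spokeDet x₀ j * Q.spokeDet x₀ (j + 1) := by
  by_contra hneg
  have hj := spokeDet_ne_zero h j
  have hj' := spokeDet_ne_zero h (j + 1)
  have hlt : Q.spokeDet x₀ j * Q.spokeDet x₀ (j + 1) < 0 :=
    lt_of_le_of_ne (not_lt.1 hneg) (mul_ne_zero hj hj')
  have h2 : j + 1 + 1 = j + 2 := by rw [add_assoc]; rfl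
  set u := Q.vertex j - x₀ with hu
  set w := Q.vertex (j + 1) - x₀ with hw
  set z := Q.vertex (j + 2) - x₀ with hz
  have e1 : Q.spokeDet x₀ j = cross2 u w := rfl
  have e2 : Q.spokeDet x₀ (j + 1) = cross2 w z := by rw [spokeDet, h2]
  rw [e1, e2] at hlt
  rw [e1] at hj
  rw [e2] at hj'
  set α := cross2 u z / cross2 w z with hα
  set β := cross2 w u / cross2 w z with hβ
  have huv : u = α • w + β • z := by
    have := cross2_smul_eq u w z
    rw [hα, hβ, div_eq_inv_mul, div_eq_inv_mul, mul_smul, mul_smul, ← smul_add, ← this, smul_smul,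
      inv_mul_cancel₀ hj', one_smul]
  have hβ0 : 0 < β := by
    have : cross2 w u = - cross2 u w := by simp [cross2]
    rw [hβ, this, neg_div, neg_pos, ← mul_div_mul_right _ _ hj']
    exact div_neg_of_neg_of_pos hlt (mul_self_pos.2 hj')
  -- The ray has direction `w + s • u`; this `s` is small enough that `1 + s * α > 0`, which puts
  -- the ray also in the cone over the next edge.
  set s : ℝ := 1 / (1 + |α|) with hs
  have hs0 : 0 < s := by positivity
  have hsα : 0 < 1 + s * α := by
    have : s * (1 + |α|) = 1 := by rw [hs]; field_simp
    nlinarith [neg_abs_le α]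
  have hsum : 0 < 1 + s * α + s * β := by positivity
  have hp := combo_mem_segment (p := Q.vertex j) (q := Q.vertex (j + 1)) hs0.le zero_le_one
    (by linarith) x₀
  have hq := combo_mem_segment (p := Q.vertex (j + 1)) (q := Q.vertex (j + 2)) hsα.le
    (mul_nonneg hs0.le hβ0.le) hsum x₀
  rw [← hu, ← hw] at hp
  rw [← hw, ← hz] at hq
  have hkey : (1 + s * α) • w + (s * β) • z = s • u + (1 : ℝ) • w := by
    rw [huv]; module
  rw [hkey] at hq
  have heq := h.eq_of_ray Q.isOpen_E (Q.segment_subset_frontier j hp)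
    (Q.segment_subset_frontier (j + 1) (by rw [h2]; exact hq))
    (s := (1 + s * α + s * β)⁻¹ * (s + 1)) (by positivity) (by
      rw [add_sub_cancel_left, add_sub_cancel_left, smul_smul, mul_assoc,
        mul_inv_cancel₀ (by positivity : s + 1 ≠ 0), mul_one])
  rw [← heq] at hq
  have hv : x₀ + (s + 1)⁻¹ • (s • u + (1 : ℝ) • w) = Q.vertex (j + 1) := by
    have := Q.adjacent_edges j
    exact mem_singleton_iff.1 (this ▸ (⟨hp, hq⟩ :
      _ ∈ segment ℝ (Q.vertex j) (Q.vertex (j + 1)) ∩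
        segment ℝ (Q.vertex (j + 1)) (Q.vertex (j + 2))))
  exact Q.vertex_succ_ne j (sub_left_injective (eq_of_combo hs0.ne' (by positivity)
    (add_left_cancel (hv.trans (by rw [hw, add_sub_cancel])) :
      (s + 1)⁻¹ • (s • u + (1 : ℝ) • w) = w))).symm

/-- The shoelace sum does not depend on the origin. -/
theorem sum_spokeDet (x₀ : Plane) : ∑ j : Fin 4, Q.spokeDet x₀ j
    = ∑ j : Fin 4, cross2 (Q.vertex j) (Q.vertex (j + 1)) := by
  simp only [Fin.sum_univ_four, spokeDet, cross2, PiLp.sub_apply]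
  have e : (3 : Fin 4) + 1 = 0 := rfl
  have e' : (2 : Fin 4) + 1 = 3 := rfl
  have e'' : (1 : Fin 4) + 1 = 2 := rfl
  rw [e, e', e'', zero_add]
  ring

/-- Neighbours agree in sign, so all four signs agree, and the total is the positive shoelace sum.
-/
theorem spokeDet_pos (h : IsStarBall Q.E x₀ r) (j : Fin 4) : 0 < Q.spokeDet x₀ j := by
  have hs : 0 < ∑ j : Fin 4, Q.spokeDet x₀ j := by
    rw [sum_spokeDet]; exact Q.counterclockwise
  have h0 := spokeDet_mul_succ_pos h 0
  have h1 := spokeDet_mul_succ_pos h 1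
  have h2 := spokeDet_mul_succ_pos h 2
  have e' : (2 : Fin 4) + 1 = 3 := rfl
  have e'' : (1 : Fin 4) + 1 = 2 := rfl
  rw [zero_add] at h0
  rw [e''] at h1
  rw [e'] at h2
  rw [Fin.sum_univ_four] at hs
  have p0 : 0 < Q.spokeDet x₀ 0 := by
    by_contra hn
    have n0 : Q.spokeDet x₀ 0 < 0 := lt_of_le_of_ne (not_lt.1 hn) (spokeDet_ne_zero h 0)
    have n1 := neg_of_mul_pos_right h0 n0.le
    have n2 := neg_of_mul_pos_right h1 n1.le
    have n3 := neg_of_mul_pos_right h2 n2.le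
    linarith
  have p1 := pos_of_mul_pos_right h0 p0.le
  have p2 := pos_of_mul_pos_right h1 p1.le
  have p3 := pos_of_mul_pos_right h2 p2.le
  fin_cases j <;> assumption

/-! ### Tiling of `E` by four triangles -/

variable (Q) in
/-- The open triangle spanned by `x₀` and the edge `e_j`. -/
def tile (x₀ : Plane) (j : Fin 4) : Set Plane :=
  openTriangle x₀ (Q.vertex j - x₀) (Q.vertex (j + 1) - x₀)

theorem tile_subset (h : IsStarBall Q.E x₀ r) (j : Fin 4) : Q.tile x₀ j ⊆ Q.E := by
  rintro x ⟨a, b, ha, hb, hab, rfl⟩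
  have hp := combo_mem_segment (p := Q.vertex j) (q := Q.vertex (j + 1)) ha.le hb.le
    (by linarith) x₀
  have := h.add_smul_mem (frontier_subset_closure (Q.segment_subset_frontier j hp))
    h.center_mem_ball (add_pos ha hb).le hab
  rwa [add_sub_cancel_left, smul_smul, mul_inv_cancel₀ (by positivity), one_smul] at this

/-- The radial projections of `x` onto the two edges lie on one ray, hence coincide. The projection
is not the vertex `i + 1` because the weight on the other endpoint is positive. -/
theorem tile_inter (h : IsStarBall Q.E x₀ r) {i j : Fin 4} {x : Plane} (hi : x ∈ Q.tile x₀ i)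
    (hj : x ∈ Q.tile x₀ j) : ∃ p, p ∈ segment ℝ (Q.vertex i) (Q.vertex (i + 1)) ∧
      p ∈ segment ℝ (Q.vertex j) (Q.vertex (j + 1)) ∧ p ≠ Q.vertex (i + 1) := by
  obtain ⟨a, b, ha, hb, hab, rfl⟩ := hi
  obtain ⟨c, d, hc, hd, hcd, he⟩ := hj
  have hp := combo_mem_segment (p := Q.vertex i) (q := Q.vertex (i + 1)) ha.le hb.le
    (by linarith) x₀
  have hq := combo_mem_segment (p := Q.vertex j) (q := Q.vertex (j + 1)) hc.le hd.le
    (by linarith) x₀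
  rw [← add_left_cancel he] at hq
  have heq := h.eq_of_ray Q.isOpen_E (Q.segment_subset_frontier i hp)
    (Q.segment_subset_frontier j hq) (s := (c + d)⁻¹ * (a + b)) (by positivity) (by
      rw [add_sub_cancel_left, add_sub_cancel_left, smul_smul, mul_assoc,
        mul_inv_cancel₀ (by positivity : a + b ≠ 0), mul_one])
  rw [← heq] at hq
  refine ⟨_, hp, hq, fun hv => ?_⟩
  exact Q.vertex_succ_ne i (sub_left_injective (eq_of_combo ha.ne' (by positivity)
    (add_left_cancel (hv.trans (add_sub_cancel x₀ _).symm)))).symm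

theorem tile_disjoint (h : IsStarBall Q.E x₀ r) :
    Pairwise (Function.onFun Disjoint (Q.tile x₀)) := by
  have h1 : ∀ i, Disjoint (Q.tile x₀ i) (Q.tile x₀ (i + 1)) := fun i => by
    rw [Set.disjoint_left]
    intro x hi hj
    obtain ⟨p, hp, hq, hne⟩ := tile_inter h hi hj
    have h2 : i + 1 + 1 = i + 2 := by rw [add_assoc]; rfl
    rw [h2] at hq
    exact hne (mem_singleton_iff.1 (Q.adjacent_edges i ▸ (⟨hp, hq⟩ :
      _ ∈ segment ℝ (Q.vertex i) (Q.vertex (i + 1)) ∩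
        segment ℝ (Q.vertex (i + 1)) (Q.vertex (i + 2)))))
  have h2 : ∀ i, Disjoint (Q.tile x₀ i) (Q.tile x₀ (i + 2)) := fun i => by
    rw [Set.disjoint_left]
    intro x hi hj
    obtain ⟨p, hp, hq, hne⟩ := tile_inter h hi hj
    have h3 : i + 2 + 1 = i + 3 := by rw [add_assoc]; rfl
    rw [h3] at hq
    exact (Q.opposite_edges i).le_bot ⟨hp, hq⟩
  intro i j hij
  have hcase : j = i + 1 ∨ j = i + 2 ∨ i = j + 1 := by revert i j; decide
  rcases hcase with rfl | rfl | rfl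
  · exact h1 i
  · exact h2 i
  · exact (h1 j).symm

/-- The ray from `x₀` through a point of `E` leaves through some edge. If it leaves through the
interior of the edge, the point is in that tile; otherwise it is on one of four lines, which are
null. -/
theorem ae_eq_iUnion_tile (h : IsStarBall Q.E x₀ r) :
    Q.E =ᵐ[volume] ⋃ j, Q.tile x₀ j := by
  have hsub : (⋃ j, Q.tile x₀ j) ⊆ Q.E := iUnion_subset (tile_subset h)
  refine Filter.EventuallyLE.antisymm ?_ hsub.eventuallyLE
  rw [ae_le_set]
  refine measure_mono_null (t := ⋃ j : Fin 4, {x : Plane | ∃ c : ℝ, x = x₀ + c • (Q.vertex j - x₀)}) ?_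
    (measure_iUnion_null fun j => volume_line _ _)
  rintro x ⟨hx, hxT⟩
  by_cases hx0 : x = x₀
  · exact mem_iUnion.2 ⟨0, 0, by simp [hx0]⟩
  obtain ⟨s, hs, hf⟩ := exists_ray_exit Q.isOpen_E Q.isBounded_E hx hx0
  rw [Q.frontier_E, mem_iUnion] at hf
  obtain ⟨j, a, b, ha, hb, hab, he⟩ := hf
  have hs0 : s ≠ 0 := by linarith
  have hspos : 0 < s⁻¹ := inv_pos.2 (by linarith)
  have hs1 : s⁻¹ < 1 := inv_lt_one_of_one_lt₀ hs
  have hxe : x = x₀ + ((s⁻¹ * a) • (Q.vertex j - x₀) + (s⁻¹ * b) • (Q.vertex (j + 1) - x₀)) := by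
    have h1 : s • (x - x₀) = a • (Q.vertex j - x₀) + b • (Q.vertex (j + 1) - x₀) := by
      have : x₀ = (a + b) • x₀ := by rw [hab, one_smul]
      calc s • (x - x₀) = (x₀ + s • (x - x₀)) - x₀ := by abel
        _ = (a • Q.vertex j + b • Q.vertex (j + 1)) - (a + b) • x₀ := by rw [he, ← this]
        _ = _ := by module
    rw [mul_smul, mul_smul, ← smul_add, ← h1, smul_smul, inv_mul_cancel₀ hs0, one_smul]
    abel
  rcases ha.eq_or_lt with rfl | ha
  · exact mem_iUnion.2 ⟨j + 1, s⁻¹ * b, by simpa using hxe⟩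
  rcases hb.eq_or_lt with rfl | hb
  · exact mem_iUnion.2 ⟨j, s⁻¹ * a, by simpa using hxe⟩
  · have hxj : x ∈ Q.tile x₀ j := ⟨_, _, mul_pos hspos ha, mul_pos hspos hb,
      by rw [← mul_add, hab, mul_one]; exact hs1, hxe⟩
    exact absurd (mem_iUnion.2 ⟨j, hxj⟩) hxT

end Quadrilateral

/-! ### Green's formula -/

/-- The mean value of `f` over the segment from `p` to `q`. -/
def segMean (p q : Plane) (f : Plane → ℝ) : ℝ :=
  ∫ t in (0 : ℝ)..1, f (AffineMap.lineMap p q t)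

theorem segMean_symm (p q : Plane) (f : Plane → ℝ) : segMean p q f = segMean q p f := by
  have := intervalIntegral.integral_comp_sub_left
    (fun t => f (AffineMap.lineMap p q t)) (1 : ℝ) (a := 0) (b := 1)
  simp only [sub_self, sub_zero, AffineMap.lineMap_apply_one_sub] at this
  rw [segMean, segMean, this]

theorem continuous_segMean_integrand {f : Plane → ℝ} (hf : Continuous f) (p q : Plane) :
    Continuous fun t : ℝ => f (AffineMap.lineMap p q t) :=
  hf.comp (AffineMap.lineMap_continuous)

/-- The standard open triangle. -/
def stdTriangle : Set (ℝ × ℝ) := {p | 0 < p.1 ∧ 0 < p.2 ∧ p.1 + p.2 < 1}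

theorem isOpen_stdTriangle : IsOpen stdTriangle := by
  refine (isOpen_lt continuous_const continuous_fst).inter
    ((isOpen_lt continuous_const continuous_snd).inter
      (isOpen_lt (continuous_fst.add continuous_snd) continuous_const))

theorem stdTriangle_subset : stdTriangle ⊆ Icc 0 1 ×ˢ Icc 0 1 := by
  rintro ⟨a, b⟩ ⟨ha, hb, hab⟩
  simp only at ha hb hab
  exact ⟨⟨ha.le, by simp; linarith⟩, ⟨hb.le, by simp; linarith⟩⟩

theorem integrableOn_stdTriangle {f : ℝ × ℝ → ℝ} (hf : Continuous f) :
    IntegrableOn f stdTriangle :=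
  (hf.locallyIntegrable.integrableOn_isCompact (isCompact_Icc.prod isCompact_Icc)).mono_set
    stdTriangle_subset

theorem integral_stdTriangle {f : ℝ × ℝ → ℝ} (hf : Continuous f) :
    ∫ p in stdTriangle, f p = ∫ b in (0 : ℝ)..1, ∫ a in (0 : ℝ)..(1 - b), f (a, b) := by
  rw [← integral_indicator isOpen_stdTriangle.measurableSet, Measure.volume_eq_prod,
    integral_prod_symm _ (by
      rw [← Measure.volume_eq_prod]
      exact (integrableOn_stdTriangle hf).integrable_indicator isOpen_stdTriangle.measurableSet),
    intervalIntegral.integral_of_le zero_le_one, integral_Ioc_eq_integral_Ioo,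
    ← integral_indicator measurableSet_Ioo]
  congr 1
  ext b
  by_cases hb : b ∈ Ioo (0 : ℝ) 1
  · rw [indicator_of_mem hb, intervalIntegral.integral_of_le (by linarith [hb.2]),
      integral_Ioc_eq_integral_Ioo, ← integral_indicator measurableSet_Ioo]
    congr 1
    ext a
    have hiff : (a, b) ∈ stdTriangle ↔ a ∈ Ioo 0 (1 - b) := by
      simp only [stdTriangle, mem_ofPred_eq, mem_Ioo]
      exact ⟨fun h => ⟨h.1, by linarith [h.2.2]⟩, fun h => ⟨h.1, hb.1, by linarith [h.2]⟩⟩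
    simp only [indicator, hiff]
  · rw [indicator_of_notMem hb]
    refine integral_eq_zero_of_ae (Filter.Eventually.of_forall fun a => ?_)
    refine indicator_of_notMem (fun h => hb ?_) _
    obtain ⟨h1, h2, h3⟩ := h
    simp only at h1 h2 h3
    exact ⟨h2, by linarith⟩

/-- The fundamental theorem of calculus on each slice parallel to `u`; the two ends of the slices
sweep out two sides of the triangle. -/
theorem integral_stdTriangle_fderiv {Φ : Plane → ℝ} (hΦ : ContDiff ℝ 1 Φ) (x₀ u w : Plane) :
    ∫ p in stdTriangle, fderiv ℝ Φ (x₀ + (p.1 • u + p.2 • w)) u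
      = segMean (x₀ + u) (x₀ + w) Φ - segMean x₀ (x₀ + w) Φ := by
  have hc : Continuous (fderiv ℝ Φ) := hΦ.continuous_fderiv one_ne_zero
  rw [integral_stdTriangle (by fun_prop), segMean, segMean, ← intervalIntegral.integral_sub
    ((continuous_segMean_integrand hΦ.continuous _ _).intervalIntegrable _ _)
    ((continuous_segMean_integrand hΦ.continuous _ _).intervalIntegrable _ _)]
  refine intervalIntegral.integral_congr fun b _ => ?_
  have hderiv : ∀ a ∈ uIcc 0 (1 - b), HasDerivAt (fun a : ℝ => Φ (x₀ + (a • u + b • w)))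
      (fderiv ℝ Φ (x₀ + (a • u + b • w)) u) a := fun a _ => by
    have h1 : HasDerivAt (fun a : ℝ => x₀ + (a • u + b • w)) u a := by
      simpa using (((hasDerivAt_id a).smul_const u).add_const (b • w)).const_add x₀
    exact ((hΦ.differentiable one_ne_zero _).hasFDerivAt).comp_hasDerivAt a h1
  simp only
  rw [intervalIntegral.integral_eq_sub_of_hasDerivAt hderiv
    ((by fun_prop : Continuous fun a : ℝ =>
      fderiv ℝ Φ (x₀ + (a • u + b • w)) u).intervalIntegrable _ _)]
  simp only [AffineMap.lineMap_apply_module]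
  congr 2 <;> module

theorem integral_stdTriangle_fderiv' {Φ : Plane → ℝ} (hΦ : ContDiff ℝ 1 Φ) (x₀ u w : Plane) :
    ∫ p in stdTriangle, fderiv ℝ Φ (x₀ + (p.1 • u + p.2 • w)) w
      = segMean (x₀ + u) (x₀ + w) Φ - segMean x₀ (x₀ + u) Φ := by
  rw [segMean_symm (x₀ + u), ← integral_stdTriangle_fderiv hΦ x₀ w u]
  have h1 : Prod.swap ⁻¹' stdTriangle = stdTriangle := by
    ext ⟨a, b⟩
    simp only [stdTriangle, mem_preimage, mem_ofPred_eq, Prod.fst_swap, Prod.snd_swap]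
    rw [add_comm b a]
    tauto
  have := (Measure.measurePreserving_swap (μ := (volume : Measure ℝ))
    (ν := (volume : Measure ℝ))).setIntegral_preimage_emb
    MeasurableEquiv.prodComm.measurableEmbedding
    (fun p : ℝ × ℝ => fderiv ℝ Φ (x₀ + (p.1 • w + p.2 • u)) w) stdTriangle
  rw [Measure.volume_eq_prod, ← this, h1]
  simp only [Prod.fst_swap, Prod.snd_swap, add_comm]

/-- Barycentric coordinates by Cramer's rule; in this form openness is visible. -/
theorem openTriangle_eq {u w : Plane} (h : 0 < cross2 u w) (x₀ : Plane) :
    openTriangle x₀ u w = {x | 0 < cross2 (x - x₀) w ∧ 0 < cross2 u (x - x₀) ∧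
      cross2 (x - x₀) w + cross2 u (x - x₀) < cross2 u w} := by
  ext x
  constructor
  · rintro ⟨a, b, ha, hb, hab, rfl⟩
    have e1 : cross2 (x₀ + (a • u + b • w) - x₀) w = a * cross2 u w := by
      simp [cross2]; ring
    have e2 : cross2 u (x₀ + (a • u + b • w) - x₀) = b * cross2 u w := by
      simp [cross2]; ring
    simp only [mem_ofPred_eq, e1, e2]
    exact ⟨by positivity, by positivity, by nlinarith⟩
  · rintro ⟨h1, h2, h3⟩
    refine ⟨cross2 (x - x₀) w / cross2 u w, cross2 u (x - x₀) / cross2 u w, by positivity,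
      by positivity, by rw [← add_div, div_lt_one h]; exact h3, ?_⟩
    have := cross2_smul_eq (x - x₀) u w
    rw [div_eq_inv_mul, div_eq_inv_mul, mul_smul, mul_smul, ← smul_add, ← this, smul_smul,
      inv_mul_cancel₀ h.ne', one_smul]
    abel

theorem isOpen_openTriangle {u w : Plane} (h : 0 < cross2 u w) (x₀ : Plane) :
    IsOpen (openTriangle x₀ u w) := by
  have c1 : Continuous fun x : Plane => cross2 (x - x₀) w := by unfold cross2; fun_prop
  have c2 : Continuous fun x : Plane => cross2 u (x - x₀) := by unfold cross2; fun_prop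
  rw [openTriangle_eq h]
  exact (isOpen_lt continuous_const c1).inter ((isOpen_lt continuous_const c2).inter
    (isOpen_lt (c1.add c2) continuous_const))

/-- The linear map of the plane that sends the standard basis to `u`, `w`. -/
def frameMap (u w : Plane) : Plane →L[ℝ] Plane :=
  (EuclideanSpace.proj (0 : Fin 2) : Plane →L[ℝ] ℝ).smulRight u +
    (EuclideanSpace.proj (1 : Fin 2) : Plane →L[ℝ] ℝ).smulRight w

theorem frameMap_apply (u w y : Plane) : frameMap u w y = y 0 • u + y 1 • w := rfl

theorem det_frameMap (u w : Plane) : (frameMap u w).det = cross2 u w := by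
  rw [ContinuousLinearMap.det,
    ← LinearMap.det_toMatrix (EuclideanSpace.basisFun (Fin 2) ℝ).toBasis, Matrix.det_fin_two]
  simp [LinearMap.toMatrix_apply, frameMap_apply, cross2]

/-- Identification of the plane with `ℝ × ℝ`. -/
def planeEquivProd : Plane ≃ᵐ ℝ × ℝ :=
  (MeasurableEquiv.toLp 2 (Fin 2 → ℝ)).symm.trans MeasurableEquiv.finTwoArrow

theorem measurePreserving_planeEquivProd : MeasurePreserving planeEquivProd :=
  (volume_preserving_finTwoArrow ℝ).comp
    (EuclideanSpace.volume_preserving_symm_measurableEquiv_toLp (Fin 2))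

theorem integral_openTriangle {u w : Plane} (h : 0 < cross2 u w) (x₀ : Plane) (F : Plane → ℝ) :
    ∫ x in openTriangle x₀ u w, F x
      = cross2 u w * ∫ p in stdTriangle, F (x₀ + (p.1 • u + p.2 • w)) := by
  have himg : openTriangle x₀ u w
      = (fun y : Plane => x₀ + frameMap u w y) '' (planeEquivProd ⁻¹' stdTriangle) := by
    ext x
    constructor
    · rintro ⟨a, b, ha, hb, hab, rfl⟩
      exact ⟨!₂[a, b], ⟨ha, hb, hab⟩, rfl⟩
    · rintro ⟨y, ⟨ha, hb, hab⟩, rfl⟩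
      exact ⟨_, _, ha, hb, hab, rfl⟩
  have hinj : Function.Injective (fun y : Plane => x₀ + frameMap u w y) := by
    intro y z hyz
    have hyz' : y 0 • u + y 1 • w = z 0 • u + z 1 • w := add_left_cancel hyz
    have e0 : cross2 (y 0 • u + y 1 • w) w = cross2 (z 0 • u + z 1 • w) w := by rw [hyz']
    have e1 : cross2 u (y 0 • u + y 1 • w) = cross2 u (z 0 • u + z 1 • w) := by rw [hyz']
    refine plane_ext (mul_right_cancel₀ h.ne' ?_) (mul_right_cancel₀ h.ne' ?_)
    · simp only [cross2, PiLp.add_apply, PiLp.smul_apply, smul_eq_mul] at e0 ⊢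
      linear_combination e0
    · simp only [cross2, PiLp.add_apply, PiLp.smul_apply, smul_eq_mul] at e1 ⊢
      linear_combination e1
  rw [himg, integral_image_eq_integral_abs_det_fderiv_smul volume
    (planeEquivProd.measurable isOpen_stdTriangle.measurableSet) (f' := fun _ => frameMap u w)
    (fun y _ => ((frameMap u w).hasFDerivAt.const_add x₀).hasFDerivWithinAt) hinj.injOn,
    ← measurePreserving_planeEquivProd.setIntegral_preimage_emb
      planeEquivProd.measurableEmbedding, det_frameMap, abs_of_pos h, ← integral_const_mul]
  rfl

/-- Cramer's rule splits `e` along `u` and `w`. For a counterclockwise side vector `d`, `cross2 e d`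
is the side length times the outward normal component of `e`, so this is the divergence theorem. -/
theorem integral_openTriangle_fderiv {u w : Plane} (h : 0 < cross2 u w) {Φ : Plane → ℝ}
    (hΦ : ContDiff ℝ 1 Φ) (x₀ e : Plane) :
    ∫ x in openTriangle x₀ u w, fderiv ℝ Φ x e
      = cross2 e (w - u) * segMean (x₀ + u) (x₀ + w) Φ - cross2 e w * segMean x₀ (x₀ + w) Φ
        + cross2 e u * segMean x₀ (x₀ + u) Φ := by
  have hc : Continuous (fderiv ℝ Φ) := hΦ.continuous_fderiv one_ne_zero
  rw [integral_openTriangle h, ← integral_const_mul]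
  have : ∀ p : ℝ × ℝ, cross2 u w * fderiv ℝ Φ (x₀ + (p.1 • u + p.2 • w)) e
      = cross2 e w * fderiv ℝ Φ (x₀ + (p.1 • u + p.2 • w)) u
        + cross2 u e * fderiv ℝ Φ (x₀ + (p.1 • u + p.2 • w)) w := fun p => by
    rw [← smul_eq_mul, ← map_smul, cross2_smul_eq, map_add, map_smul, map_smul, smul_eq_mul,
      smul_eq_mul]
  simp only [this]
  rw [integral_add (integrableOn_stdTriangle (by fun_prop)).integrable
    (integrableOn_stdTriangle (by fun_prop)).integrable, integral_const_mul, integral_const_mul,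
    integral_stdTriangle_fderiv hΦ, integral_stdTriangle_fderiv' hΦ]
  simp only [cross2, PiLp.sub_apply]
  ring

theorem integrableOn_of_isBounded {S : Set Plane} (hS : Bornology.IsBounded S) {F : Type*}
    [NormedAddCommGroup F] {f : Plane → F} (hf : Continuous f) : IntegrableOn f S :=
  (hf.locallyIntegrable.integrableOn_isCompact hS.isCompact_closure).mono_set subset_closure

namespace Quadrilateral

variable {Q : Quadrilateral} {x₀ : Plane} {r : ℝ}

theorem edgeIntegral_eq (Q : Quadrilateral) (j : Fin 4) (f : Plane → ℝ) :
    Q.edgeIntegral j f = Q.edgeLength j * segMean (Q.vertex j) (Q.vertex (j + 1)) f := rfl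

theorem isOpen_tile (h : IsStarBall Q.E x₀ r) (j : Fin 4) : IsOpen (Q.tile x₀ j) :=
  isOpen_openTriangle (spokeDet_pos h j) x₀

theorem integral_tile_fderiv (h : IsStarBall Q.E x₀ r) {Φ : Plane → ℝ}
    (hΦ : ContDiff ℝ 1 Φ) (j : Fin 4) (e : Plane) :
    ∫ x in Q.tile x₀ j, fderiv ℝ Φ x e
      = cross2 e (Q.vertex (j + 1) - Q.vertex j) * segMean (Q.vertex j) (Q.vertex (j + 1)) Φ
        - cross2 e (Q.vertex (j + 1) - x₀) * segMean x₀ (Q.vertex (j + 1)) Φ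
        + cross2 e (Q.vertex j - x₀) * segMean x₀ (Q.vertex j) Φ := by
  rw [tile, integral_openTriangle_fderiv (spokeDet_pos h j) hΦ, add_sub_cancel, add_sub_cancel,
    sub_sub_sub_cancel_right]

theorem integral_eq_sum_tile (h : IsStarBall Q.E x₀ r) {f : Plane → ℝ}
    (hf : IntegrableOn f Q.E) : ∫ x in Q.E, f x = ∑ j, ∫ x in Q.tile x₀ j, f x := by
  rw [setIntegral_congr_set (ae_eq_iUnion_tile h),
    integral_iUnion_fintype (fun j => (isOpen_tile h j).measurableSet) (tile_disjoint h)
      fun j => hf.mono_set (tile_subset h j)]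

/-- Green's formula on a star-shaped quadrilateral. -/
theorem integral_fderiv (h : IsStarBall Q.E x₀ r) {Φ : Plane → ℝ} (hΦ : ContDiff ℝ 1 Φ)
    (e : Plane) :
    ∫ x in Q.E, fderiv ℝ Φ x e
      = ∑ j, cross2 e (Q.vertex (j + 1) - Q.vertex j) *
          segMean (Q.vertex j) (Q.vertex (j + 1)) Φ := by
  have hc : Continuous (fderiv ℝ Φ) := hΦ.continuous_fderiv one_ne_zero
  rw [integral_eq_sum_tile h (integrableOn_of_isBounded Q.isBounded_E (by fun_prop))]
  simp only [integral_tile_fderiv h hΦ]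
  -- Each spoke belongs to two tiles with opposite orientations, so its contributions cancel after a
  -- cyclic shift.
  have hshift : ∑ j, cross2 e (Q.vertex (j + 1) - x₀) * segMean x₀ (Q.vertex (j + 1)) Φ
      = ∑ j, cross2 e (Q.vertex j - x₀) * segMean x₀ (Q.vertex j) Φ :=
    Equiv.sum_comp (Equiv.addRight (1 : Fin 4))
      (fun j => cross2 e (Q.vertex j - x₀) * segMean x₀ (Q.vertex j) Φ)
  rw [Finset.sum_add_distrib, Finset.sum_sub_distrib, hshift]
  ring

/-! ### An explicit field with alternating fluxes -/

/-- The weights `(-1)^j` of the edges, counted from `1` on. -/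
def edgeSign (j : Fin 4) : ℝ := (-1) ^ ((j : ℕ) + 1)

/-- A bounded field with the normal trace of the hourglass function. -/
theorem exists_piecewise_field (h : IsStarBall Q.E x₀ r) :
    ∃ σ : Plane → Plane, MemLp σ 2 (volume.restrict Q.E) ∧
      ∀ φ : Plane → ℝ, ContDiff ℝ 1 φ → ∫ x in Q.E, fderiv ℝ φ x (σ x)
        = ∑ j, edgeSign j * segMean (Q.vertex j) (Q.vertex (j + 1)) φ := by
  classical
  -- Vertex values of a continuous piecewise linear stream function that vanishes at `x₀`; its
  -- increments along the edges are the alternating signs. On tile `j` its rotated gradient is the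
  -- constant `s j`.
  let ψ : Fin 4 → ℝ := ![0, -1, 0, -1]
  let s : Fin 4 → Plane := fun j => (Q.spokeDet x₀ j)⁻¹ •
    (ψ (j + 1) • (Q.vertex j - x₀) - ψ j • (Q.vertex (j + 1) - x₀))
  have hs0 : ∀ j, cross2 (s j) (Q.vertex j - x₀) = ψ j := fun j => by
    have hD := (spokeDet_pos h j).ne'
    have : cross2 (s j) (Q.vertex j - x₀) = (Q.spokeDet x₀ j)⁻¹ * (ψ j * Q.spokeDet x₀ j) := by
      simp [s, spokeDet, cross2]; ring
    rw [this]; field_simp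
  have hs1 : ∀ j, cross2 (s j) (Q.vertex (j + 1) - x₀) = ψ (j + 1) := fun j => by
    have hD := (spokeDet_pos h j).ne'
    have : cross2 (s j) (Q.vertex (j + 1) - x₀)
        = (Q.spokeDet x₀ j)⁻¹ * (ψ (j + 1) * Q.spokeDet x₀ j) := by
      simp [s, spokeDet, cross2]; ring
    rw [this]; field_simp
  have hs2 : ∀ j, cross2 (s j) (Q.vertex (j + 1) - Q.vertex j) = edgeSign j := fun j => by
    have : cross2 (s j) (Q.vertex (j + 1) - Q.vertex j) = ψ (j + 1) - ψ j := by
      rw [← hs0 j, ← hs1 j]; simp [cross2]; ring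
    rw [this]
    fin_cases j <;> norm_num [ψ, edgeSign] <;> rfl
  have hm := fun j => (isOpen_tile h j).measurableSet
  have : IsFiniteMeasure (volume.restrict Q.E) :=
    ⟨by simpa using Q.isBounded_E.measure_lt_top⟩
  refine ⟨fun x => ∑ j, (Q.tile x₀ j).indicator (fun _ => s j) x, ?_, fun φ hφ => ?_⟩
  · exact memLp_finsetSum _ fun j _ => (MeasureTheory.memLp_const (s j)).indicator (hm j)
  · have hc : Continuous (fderiv ℝ φ) := hφ.continuous_fderiv one_ne_zero
    have hi : ∀ j, IntegrableOn (fun x => fderiv ℝ φ x (s j)) Q.E := fun j =>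
      integrableOn_of_isBounded Q.isBounded_E (by fun_prop)
    have e1 : ∀ x, fderiv ℝ φ x (∑ j, (Q.tile x₀ j).indicator (fun _ => s j) x)
        = ∑ j, (Q.tile x₀ j).indicator (fun x => fderiv ℝ φ x (s j)) x := fun x => by
      rw [map_sum]
      refine Finset.sum_congr rfl fun j _ => ?_
      by_cases hx : x ∈ Q.tile x₀ j <;> simp [hx]
    simp only [e1]
    rw [integral_finsetSum _ fun j _ => (hi j).integrable.indicator (hm j)]
    simp only [setIntegral_indicator (hm _), inter_eq_self_of_subset_right (tile_subset h _),
      integral_tile_fderiv h hφ, hs0, hs1, hs2]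
    -- The fluxes through a spoke match from both sides, since both equal the value of `ψ` at its
    -- vertex.
    have hshift : ∑ j, ψ (j + 1) * segMean x₀ (Q.vertex (j + 1)) φ
        = ∑ j, ψ j * segMean x₀ (Q.vertex j) φ :=
      Equiv.sum_comp (Equiv.addRight (1 : Fin 4)) (fun j => ψ j * segMean x₀ (Q.vertex j) φ)
    rw [Finset.sum_add_distrib, Finset.sum_sub_distrib, hshift]
    ring

end Quadrilateral

/-! ### Weak gradients -/

theorem inner_gradient_real (φ : Plane → ℝ) (x e : Plane) :
    inner ℝ (gradient φ x) e = fderiv ℝ φ x e := by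
  simp [gradient, InnerProductSpace.toDual_symm_apply]

theorem real_inner_gradient (φ : Plane → ℝ) (x e : Plane) :
    inner ℝ e (gradient φ x) = fderiv ℝ φ x e := by
  rw [real_inner_comm, inner_gradient_real]

theorem continuous_gradient {φ : Plane → ℝ} (h : ContDiff ℝ 1 φ) : Continuous (gradient φ) :=
  (InnerProductSpace.toDual ℝ Plane).symm.continuous.comp (h.continuous_fderiv one_ne_zero)

theorem IsTestFunction.contDiff_one {U : Set Plane} {φ : Plane → ℝ} (h : IsTestFunction U φ) :
    ContDiff ℝ 1 φ := h.1.of_le (by exact_mod_cast le_top)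

theorem IsTestFunction.mono {U V : Set Plane} {φ : Plane → ℝ} (h : IsTestFunction U φ)
    (hUV : U ⊆ V) : IsTestFunction V φ := ⟨h.1, h.2.1, h.2.2.trans hUV⟩

theorem IsTestFunction.eq_zero {U : Set Plane} {φ : Plane → ℝ} (h : IsTestFunction U φ)
    {x : Plane} (hx : x ∉ U) : φ x = 0 :=
  image_eq_zero_of_notMem_tsupport fun hx' => hx (h.2.2 hx')

theorem IsTestFunction.fderiv_eq_zero {U : Set Plane} {φ : Plane → ℝ} (h : IsTestFunction U φ)
    {x : Plane} (hx : x ∉ U) : fderiv ℝ φ x = 0 :=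
  image_eq_zero_of_notMem_tsupport fun hx' => hx (h.2.2 (tsupport_fderiv_subset ℝ hx'))

theorem IsTestFunction.memLp_fderiv {U : Set Plane} {φ : Plane → ℝ} (h : IsTestFunction U φ)
    (S : Set Plane) (e : Plane) : MemLp (fun x => fderiv ℝ φ x e) 2 (volume.restrict S) := by
  have hc : Continuous fun x => fderiv ℝ φ x e :=
    (h.contDiff_one.continuous_fderiv one_ne_zero).clm_apply continuous_const
  exact (hc.memLp_of_hasCompactSupport (h.2.1.fderiv_apply (𝕜 := ℝ) e)).restrict S

theorem hasWeakGradient_iff {U : Set Plane} {v : Plane → ℝ} {g : Plane → Plane}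
    (hv : MemLp v 2 (volume.restrict U)) (hg : MemLp g 2 (volume.restrict U)) :
    HasWeakGradient U v g ↔ ∀ φ, IsTestFunction U φ → ∀ e : Plane,
      ∫ x in U, v x * fderiv ℝ φ x e = -∫ x in U, φ x * inner ℝ (g x) e := by
  have key : ∀ φ, IsTestFunction U φ → ∀ e : Plane,
      inner ℝ e (∫ x in U, v x • gradient φ x) = ∫ x in U, v x * fderiv ℝ φ x e ∧
      inner ℝ e (∫ x in U, φ x • g x) = ∫ x in U, φ x * inner ℝ (g x) e := fun φ hφ e => by
    rw [← integral_inner (integrable_smul_of_memLp hv (hφ.memLp_gradient U)),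
      ← integral_inner (integrable_smul_of_memLp (hφ.memLp U) hg)]
    simp only [real_inner_smul_right, real_inner_gradient]
    refine ⟨trivial, ?_⟩
    simp only [real_inner_comm]
  constructor
  · intro h φ hφ e
    rw [← (key φ hφ e).1, ← (key φ hφ e).2, h φ hφ, inner_neg_right]
  · intro h φ hφ
    refine ext_inner_left ℝ fun e => ?_
    rw [inner_neg_right, (key φ hφ e).1, (key φ hφ e).2, h φ hφ]

theorem memLp_of_isBounded {S : Set Plane} (hS : Bornology.IsBounded S) {F : Type*}
    [NormedAddCommGroup F] {f : Plane → F} (hf : Continuous f) :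
    MemLp f 2 (volume.restrict S) := by
  have h1 : IsFiniteMeasure (volume.restrict S) := ⟨by simpa using hS.measure_lt_top⟩
  obtain ⟨C, hC⟩ := hS.isCompact_closure.exists_bound_of_continuousOn hf.continuousOn
  have hb : ∀ᵐ x ∂volume.restrict S, ‖f x‖ ≤ C := by
    refine ae_restrict_of_ae_restrict_of_subset (t := closure S) subset_closure ?_
    exact (ae_restrict_mem isClosed_closure.measurableSet).mono fun x hx => hC x hx
  exact MemLp.of_bound (hf.aestronglyMeasurable) C hb

theorem hasWeakGradient_of_contDiff {U : Set Plane}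
    (hb : Bornology.IsBounded U) {Φ : Plane → ℝ} (hΦ : ContDiff ℝ 1 Φ) :
    HasWeakGradient U Φ (gradient Φ) := by
  rw [hasWeakGradient_iff (memLp_of_isBounded hb hΦ.continuous)
    (memLp_of_isBounded hb (continuous_gradient hΦ))]
  intro φ hφ e
  have hφ1 := hφ.contDiff_one
  have hc : Continuous fun x => fderiv ℝ φ x e :=
    (hφ1.continuous_fderiv one_ne_zero).clm_apply continuous_const
  have hc' : Continuous fun x => fderiv ℝ Φ x e :=
    (hΦ.continuous_fderiv one_ne_zero).clm_apply continuous_const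
  simp only [inner_gradient_real]
  rw [setIntegral_eq_integral_of_forall_compl_eq_zero fun x hx => by
      rw [hφ.fderiv_eq_zero hx]; simp,
    setIntegral_eq_integral_of_forall_compl_eq_zero fun x hx => by
      rw [hφ.eq_zero hx]; simp,
    integral_mul_fderiv_eq_neg_fderiv_mul_of_integrable]
  · simp only [mul_comm]
  · exact (hc'.mul hφ1.continuous).integrable_of_hasCompactSupport hφ.2.1.mul_left
  · exact (hΦ.continuous.mul hc).integrable_of_hasCompactSupport
      (HasCompactSupport.mul_left (hφ.2.1.fderiv_apply (𝕜 := ℝ) e))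
  · exact (hΦ.continuous.mul hφ1.continuous).integrable_of_hasCompactSupport hφ.2.1.mul_left
  · exact fun x _ => hΦ.differentiable one_ne_zero x
  · exact fun x _ => hφ1.differentiable one_ne_zero x

/-! ### A Poincaré inequality -/

/-- Cauchy-Schwarz against the constant 1. -/
theorem sq_lintegral_le {α : Type*} [MeasurableSpace α] (μ : Measure α) {f : α → ENNReal}
    (hf : AEMeasurable f μ) : (∫⁻ x, f x ∂μ) ^ 2 ≤ μ univ * ∫⁻ x, f x ^ 2 ∂μ := by
  have h := ENNReal.lintegral_mul_le_Lp_mul_Lq μ Real.HolderConjugate.two_two hf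
    (aemeasurable_const (b := (1 : ENNReal)))
  simp only [Pi.mul_apply, mul_one, ENNReal.one_rpow, lintegral_one] at h
  calc (∫⁻ x, f x ∂μ) ^ 2
      ≤ ((∫⁻ x, f x ^ (2 : ℝ) ∂μ) ^ (1 / (2 : ℝ)) * μ univ ^ (1 / (2 : ℝ))) ^ 2 := by gcongr
    _ = μ univ * ∫⁻ x, f x ^ 2 ∂μ := by
      rw [mul_pow, ← ENNReal.rpow_natCast, ← ENNReal.rpow_natCast, ← ENNReal.rpow_mul,
        ← ENNReal.rpow_mul, mul_comm]
      norm_num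

theorem lintegral_comp_add_smul {f : Plane → ENNReal} (hf : Measurable f) (c : Plane) {t : ℝ}
    (ht : t ≠ 0) :
    ∫⁻ x, f (c + t • x) = ENNReal.ofReal |(t ^ 2)⁻¹| * ∫⁻ x, f x := by
  have h1 := lintegral_map (μ := (volume : Measure Plane)) (f := fun x => f (c + x))
    (g := fun x => t • x) (by fun_prop) (by fun_prop)
  rw [Measure.map_addHaar_smul _ ht, lintegral_smul_measure, lintegral_add_left_eq_self] at h1
  rw [← h1]
  simp

theorem lintegral_comp_add_smul_le {f : Plane → ENNReal} (hf : Measurable f) (c : Plane) {t : ℝ}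
    (ht : 1 / 2 ≤ t) : ∫⁻ x, f (c + t • x) ≤ 4 * ∫⁻ x, f x := by
  rw [lintegral_comp_add_smul hf c (by linarith)]
  gcongr
  rw [abs_of_nonneg (by positivity)]
  refine (ENNReal.ofReal_le_ofReal (q := 4) ?_).trans (by norm_num)
  rw [inv_le_comm₀ (by positivity) (by norm_num)]
  nlinarith

/-- For fixed `t` the point of the segment replaces `x` as variable when `t ≥ 1/2` and `y` when `t ≤
1/2`. The Jacobian factor is then at most `(1/2)⁻² = 4` in both cases. -/
theorem lintegral_segments_le {G : Plane → ENNReal} (hG : Measurable G) (S T : Set Plane) :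
    ∫⁻ x in S, ∫⁻ y in T, ∫⁻ t in Ioo (0 : ℝ) 1, G (y + t • (x - y))
      ≤ 4 * (volume S + volume T) * ∫⁻ x, G x := by
  have hmeas : ∀ t : ℝ, Measurable fun p : Plane × Plane => G (p.2 + t • (p.1 - p.2)) :=
    fun t => hG.comp (by fun_prop)
  have hslice : ∀ t ∈ Ioo (0 : ℝ) 1, ∫⁻ x in S, ∫⁻ y in T, G (y + t • (x - y))
      ≤ 4 * (volume S + volume T) * ∫⁻ x, G x := by
    intro t ht
    rcases le_total (1 / 2) t with h | h
    · rw [lintegral_lintegral_swap (hmeas t).aemeasurable]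
      calc ∫⁻ y in T, ∫⁻ x in S, G (y + t • (x - y))
          ≤ ∫⁻ y in T, 4 * ∫⁻ x, G x := by
            refine lintegral_mono fun y => (setLIntegral_le_lintegral _ _).trans ?_
            refine le_trans (le_of_eq ?_) (lintegral_comp_add_smul_le hG ((1 - t) • y) h)
            refine lintegral_congr fun x => ?_
            congr 1; module
        _ = 4 * volume T * ∫⁻ x, G x := by
            rw [setLIntegral_const]; ring
        _ ≤ _ := by gcongr; exact le_add_self
    · calc ∫⁻ x in S, ∫⁻ y in T, G (y + t • (x - y))
          ≤ ∫⁻ x in S, 4 * ∫⁻ x, G x := by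
            refine lintegral_mono fun x => (setLIntegral_le_lintegral _ _).trans ?_
            refine le_trans (le_of_eq ?_) (lintegral_comp_add_smul_le hG (t • x)
              (by linarith : 1 / 2 ≤ 1 - t))
            refine lintegral_congr fun y => ?_
            congr 1; module
        _ = 4 * volume S * ∫⁻ x, G x := by
            rw [setLIntegral_const]; ring
        _ ≤ _ := by gcongr; exact le_self_add
  have hm1 : ∀ x : Plane, Measurable fun p : Plane × ℝ => G (p.1 + p.2 • (x - p.1)) :=
    fun x => hG.comp (by fun_prop)
  have hm2 : Measurable fun q : (Plane × ℝ) × Plane => G (q.2 + q.1.2 • (q.1.1 - q.2)) :=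
    hG.comp (by fun_prop)
  have e1 : ∀ x : Plane, ∫⁻ y in T, ∫⁻ t in Ioo (0 : ℝ) 1, G (y + t • (x - y))
      = ∫⁻ t in Ioo (0 : ℝ) 1, ∫⁻ y in T, G (y + t • (x - y)) := fun x =>
    lintegral_lintegral_swap (hm1 x).aemeasurable
  simp only [e1]
  rw [lintegral_lintegral_swap (f := fun (x : Plane) (t : ℝ) => ∫⁻ y in T, G (y + t • (x - y)))
    (Measurable.lintegral_prod_right' hm2).aemeasurable]
  calc ∫⁻ t in Ioo (0 : ℝ) 1, ∫⁻ x in S, ∫⁻ y in T, G (y + t • (x - y))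
      ≤ ∫⁻ t in Ioo (0 : ℝ) 1, 4 * (volume S + volume T) * ∫⁻ x, G x :=
        setLIntegral_mono' measurableSet_Ioo hslice
    _ = _ := by rw [setLIntegral_const]; simp

theorem enorm_sub_sq_le {φ : Plane → ℝ} (hφ : ContDiff ℝ 1 φ) (x y : Plane) :
    ‖φ x - φ y‖ₑ ^ 2
      ≤ ‖x - y‖ₑ ^ 2 * ∫⁻ t in Ioo (0 : ℝ) 1, ‖gradient φ (y + t • (x - y))‖ₑ ^ 2 := by
  have hc : Continuous (gradient φ) := continuous_gradient hφ
  have hderiv : ∀ t ∈ uIcc (0 : ℝ) 1, HasDerivAt (fun t : ℝ => φ (y + t • (x - y)))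
      (inner ℝ (gradient φ (y + t • (x - y))) (x - y)) t := fun t _ => by
    have h1 : HasDerivAt (fun t : ℝ => y + t • (x - y)) (x - y) t := by
      simpa using ((hasDerivAt_id t).smul_const (x - y)).const_add y
    rw [inner_gradient_real]
    exact ((hφ.differentiable one_ne_zero _).hasFDerivAt).comp_hasDerivAt t h1
  have hFTC := intervalIntegral.integral_eq_sub_of_hasDerivAt hderiv
    ((by fun_prop : Continuous fun t : ℝ =>
      inner ℝ (gradient φ (y + t • (x - y))) (x - y)).intervalIntegrable _ _)
  simp only [one_smul, zero_smul, add_zero, add_sub_cancel] at hFTC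
  rw [← hFTC, intervalIntegral.integral_of_le zero_le_one, integral_Ioc_eq_integral_Ioo]
  have hm : Measurable fun t : ℝ => ‖gradient φ (y + t • (x - y))‖ₑ :=
    (hc.comp (by fun_prop : Continuous fun t : ℝ => y + t • (x - y))).enorm.measurable
  have hle : ‖∫ t in Ioo (0 : ℝ) 1, (inner ℝ (gradient φ (y + t • (x - y))) (x - y) : ℝ)‖ₑ
      ≤ ‖x - y‖ₑ * ∫⁻ t in Ioo (0 : ℝ) 1, ‖gradient φ (y + t • (x - y))‖ₑ := by
    refine (enorm_integral_le_lintegral_enorm _).trans ?_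
    rw [← lintegral_const_mul _ hm]
    refine lintegral_mono fun t => ?_
    rw [mul_comm]
    simp only [← ofReal_norm]
    rw [← ENNReal.ofReal_mul (norm_nonneg _)]
    exact ENNReal.ofReal_le_ofReal (norm_inner_le_norm _ _)
  calc _ ≤ (‖x - y‖ₑ * ∫⁻ t in Ioo (0 : ℝ) 1, ‖gradient φ (y + t • (x - y))‖ₑ) ^ 2 := by gcongr
    _ ≤ _ := by
      rw [mul_pow]
      gcongr
      refine (sq_lintegral_le _ hm.aemeasurable).trans ?_
      simp

/-- Jensen bounds the deviation from the mean over the ball by the average of `|φ x - φ y|²` over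
`y` in the ball. Each difference is an integral of the gradient along a segment, which stays in `E`,
and `lintegral_segments_le` sums these up. -/
theorem IsStarBall.exists_poincare {E : Set Plane} {x₀ : Plane} {r : ℝ} (h : IsStarBall E x₀ r)
    (hE : IsOpen E) (hb : Bornology.IsBounded E) :
    ∃ C : NNReal, ∀ φ : Plane → ℝ, ContDiff ℝ 1 φ →
      eLpNorm (fun x => φ x - ⨍ y in Metric.ball x₀ r, φ y) 2 (volume.restrict E)
        ≤ C * eLpNorm (gradient φ) 2 (volume.restrict E) := by
  set B := Metric.ball x₀ r with hB
  have hBvol : volume B ≠ 0 := (Metric.measure_ball_pos volume x₀ h.pos).ne'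
  have hBtop : volume B ≠ ⊤ := Metric.isBounded_ball.measure_lt_top.ne
  have hEtop : volume E ≠ ⊤ := hb.measure_lt_top.ne
  set D : ENNReal := Metric.ediam E with hD
  have hDtop : D ≠ ⊤ := hb.ediam_ne_top
  set K : ENNReal := (volume B)⁻¹ * (D ^ 2 * (4 * (volume E + volume B))) with hK
  have hKtop : K ≠ ⊤ := by
    refine ENNReal.mul_ne_top (ENNReal.inv_ne_top.2 hBvol) (ENNReal.mul_ne_top
      (ENNReal.pow_ne_top hDtop) (ENNReal.mul_ne_top (by norm_num)
        (ENNReal.add_ne_top.2 ⟨hEtop, hBtop⟩)))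
  have main : ∀ φ : Plane → ℝ, ContDiff ℝ 1 φ →
      ∫⁻ x in E, ‖φ x - ⨍ y in B, φ y‖ₑ ^ 2 ≤ K * ∫⁻ x in E, ‖gradient φ x‖ₑ ^ 2 := by
    intro φ hφ
    have hc : Continuous (gradient φ) := continuous_gradient hφ
    have hφc := hφ.continuous
    -- Extension by zero allows changes of variable in the whole plane and costs nothing on segments
    -- inside `E`.
    set G : Plane → ENNReal := E.indicator fun x => ‖gradient φ x‖ₑ ^ 2 with hG
    have hGm : Measurable G := (hc.enorm.measurable.pow_const 2).indicator
      hE.measurableSet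
    have hGi : ∫⁻ x, G x = ∫⁻ x in E, ‖gradient φ x‖ₑ ^ 2 := lintegral_indicator hE.measurableSet _
    have hpt : ∀ x ∈ E, ∀ y ∈ B, ‖φ x - φ y‖ₑ ^ 2
        ≤ D ^ 2 * ∫⁻ t in Ioo (0 : ℝ) 1, G (y + t • (x - y)) := by
      intro x hx y hy
      refine (enorm_sub_sq_le hφ x y).trans ?_
      refine mul_le_mul' (pow_le_pow_left₀ zero_le ?_ 2) ?_
      · rw [← edist_eq_enorm_sub]
        exact Metric.edist_le_ediam_of_mem hx (h.ball_subset hy)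
      · refine setLIntegral_mono' measurableSet_Ioo fun t ht => ?_
        rw [hG, indicator_of_mem (h.add_smul_mem (subset_closure hx) hy ht.1.le ht.2)]
    have hmean : ∀ x, ‖φ x - ⨍ y in B, φ y‖ₑ ^ 2
        ≤ (volume B)⁻¹ * ∫⁻ y in B, ‖φ x - φ y‖ₑ ^ 2 := by
      intro x
      have hBr : volume.real B ≠ 0 := by
        rw [measureReal_def]; exact (ENNReal.toReal_ne_zero).2 ⟨hBvol, hBtop⟩
      have hint : IntegrableOn φ B := integrableOn_of_isBounded Metric.isBounded_ball hφc
      have e1 : ∫ y in B, (φ x - φ y) = volume.real B * (φ x - ⨍ y in B, φ y) := by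
        rw [integral_sub (integrableOn_const (C := φ x) hBtop).integrable hint.integrable, setIntegral_const, setAverage_eq]
        simp only [smul_eq_mul]
        field_simp
      have e2 : volume B * ‖φ x - ⨍ y in B, φ y‖ₑ ≤ ∫⁻ y in B, ‖φ x - φ y‖ₑ := by
        refine le_trans (le_of_eq ?_) (enorm_integral_le_lintegral_enorm _)
        rw [e1, enorm_mul, Real.enorm_of_nonneg measureReal_nonneg, measureReal_def,
          ENNReal.ofReal_toReal hBtop]
      have e3 := sq_lintegral_le (volume.restrict B) (f := fun y => ‖φ x - φ y‖ₑ) (by fun_prop)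
      rw [Measure.restrict_apply_univ] at e3
      have e4 : volume B * (volume B * ‖φ x - ⨍ y in B, φ y‖ₑ ^ 2)
          ≤ volume B * ∫⁻ y in B, ‖φ x - φ y‖ₑ ^ 2 := by
        refine le_trans (le_of_eq (by ring)) ((pow_le_pow_left₀ zero_le e2 2).trans e3)
      rw [ENNReal.mul_le_mul_iff_right hBvol hBtop] at e4
      rwa [← ENNReal.mul_le_iff_le_inv hBvol hBtop]
    calc ∫⁻ x in E, ‖φ x - ⨍ y in B, φ y‖ₑ ^ 2
        ≤ ∫⁻ x in E, (volume B)⁻¹ * ∫⁻ y in B, D ^ 2 * ∫⁻ t in Ioo (0 : ℝ) 1, G (y + t • (x - y)) :=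
          setLIntegral_mono' hE.measurableSet fun x hx => (hmean x).trans <| by
            gcongr _ * ?_
            exact setLIntegral_mono' Metric.isOpen_ball.measurableSet (hpt x hx)
      _ = (volume B)⁻¹ * (D ^ 2 *
            ∫⁻ x in E, ∫⁻ y in B, ∫⁻ t in Ioo (0 : ℝ) 1, G (y + t • (x - y))) := by
          rw [lintegral_const_mul' _ _ (ENNReal.inv_ne_top.2 hBvol)]
          simp only [lintegral_const_mul' _ _ (ENNReal.pow_ne_top hDtop)]
      _ ≤ (volume B)⁻¹ * (D ^ 2 * (4 * (volume E + volume B) * ∫⁻ x, G x)) := by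
          gcongr
          exact lintegral_segments_le hGm E B
      _ = _ := by rw [hGi, hK]; ring
  refine ⟨(K ^ (1 / 2 : ℝ)).toNNReal, fun φ hφ => ?_⟩
  rw [ENNReal.coe_toNNReal (ENNReal.rpow_ne_top_of_nonneg (by norm_num) hKtop),
    eLpNorm_eq_lintegral_rpow_enorm_toReal two_ne_zero ENNReal.ofNat_ne_top,
    eLpNorm_eq_lintegral_rpow_enorm_toReal two_ne_zero ENNReal.ofNat_ne_top]
  simp only [ENNReal.toReal_ofNat, ENNReal.rpow_ofNat]
  rw [← ENNReal.mul_rpow_of_nonneg _ _ (by norm_num)]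
  exact ENNReal.rpow_le_rpow (main φ hφ) (by norm_num)

/-! ### The space of gradients of smooth functions and its closure -/

theorem IsTestFunction.zero {U : Set Plane} : IsTestFunction U (0 : Plane → ℝ) :=
  ⟨contDiff_const, HasCompactSupport.zero, by simp [tsupport]⟩

theorem IsTestFunction.add {U : Set Plane} {φ ψ : Plane → ℝ} (hφ : IsTestFunction U φ)
    (hψ : IsTestFunction U ψ) : IsTestFunction U (φ + ψ) :=
  ⟨hφ.1.add hψ.1, hφ.2.1.add hψ.2.1, (tsupport_add φ ψ).trans (union_subset hφ.2.2 hψ.2.2)⟩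

theorem IsTestFunction.const_smul {U : Set Plane} {φ : Plane → ℝ} (a : ℝ)
    (hφ : IsTestFunction U φ) : IsTestFunction U (a • φ) :=
  ⟨hφ.1.const_smul a, hφ.2.1.smul_left (f := fun _ => a),
    (tsupport_smul_subset_right (fun _ => a) φ).trans hφ.2.2⟩

theorem IsTestFunction.sub {U : Set Plane} {φ ψ : Plane → ℝ} (hφ : IsTestFunction U φ)
    (hψ : IsTestFunction U ψ) : IsTestFunction U (φ - ψ) := by
  have := hφ.add (hψ.const_smul (-1))
  rwa [neg_one_smul, ← sub_eq_add_neg] at this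

theorem gradient_add_apply {φ ψ : Plane → ℝ} {x : Plane} (hφ : DifferentiableAt ℝ φ x)
    (hψ : DifferentiableAt ℝ ψ x) : gradient (φ + ψ) x = gradient φ x + gradient ψ x := by
  simp only [gradient, fderiv_add hφ hψ, map_add]

theorem gradient_const_smul_apply {φ : Plane → ℝ} {x : Plane} (a : ℝ)
    (hφ : DifferentiableAt ℝ φ x) : gradient (a • φ) x = a • gradient φ x := by
  simp only [gradient, fderiv_const_smul hφ, map_smul]

/-- The gradients of smooth functions, as a subspace of `L²(E)²`. -/
def gradSpace (E : Set Plane) : Submodule ℝ (L2Field E) where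
  carrier := {τ | ∃ φ : Plane → ℝ, IsTestFunction univ φ ∧
    τ =ᵐ[volume.restrict E] gradient φ}
  add_mem' {σ τ} := by
    rintro ⟨φ, hφ, h₁⟩ ⟨ψ, hψ, h₂⟩
    refine ⟨φ + ψ, hφ.add hψ, ?_⟩
    filter_upwards [h₁, h₂, Lp.coeFn_add σ τ] with x a b c
    rw [c, Pi.add_apply, a, b, gradient_add_apply (hφ.contDiff_one.differentiable one_ne_zero x)
      (hψ.contDiff_one.differentiable one_ne_zero x)]
  zero_mem' := by
    refine ⟨0, .zero, ?_⟩
    filter_upwards [Lp.coeFn_zero Plane 2 (volume.restrict E)] with x a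
    rw [a]
    simp [gradient]
  smul_mem' s τ := by
    rintro ⟨φ, hφ, h₁⟩
    refine ⟨s • φ, hφ.const_smul s, ?_⟩
    filter_upwards [h₁, Lp.coeFn_smul s τ] with x a c
    rw [c, Pi.smul_apply, a,
      gradient_const_smul_apply s (hφ.contDiff_one.differentiable one_ne_zero x)]

theorem IsTestFunction.toLp_gradient_mem {U : Set Plane} {φ : Plane → ℝ} (h : IsTestFunction U φ)
    (E : Set Plane) : (h.memLp_gradient E).toLp ∈ gradSpace E :=
  ⟨φ, h.mono (subset_univ _), (h.memLp_gradient E).coeFn_toLp⟩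

theorem inner_L2Field_eq {E : Set Plane} (τ : L2Field E) {g : Plane → Plane}
    (hg : MemLp g 2 (volume.restrict E)) :
    inner ℝ τ hg.toLp = ∫ x in E, inner ℝ (τ x) (g x) := by
  rw [L2.inner_def]
  refine integral_congr_ae ?_
  filter_upwards [hg.coeFn_toLp] with x hx
  rw [hx]

theorem tendsto_integral_mul {E : Set Plane} {u : ℕ → Lp ℝ 2 (volume.restrict E)}
    {v : Lp ℝ 2 (volume.restrict E)} (h : Filter.Tendsto u Filter.atTop (nhds v)) {g : Plane → ℝ}
    (hg : MemLp g 2 (volume.restrict E)) :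
    Filter.Tendsto (fun n => ∫ x in E, u n x * g x) Filter.atTop
      (nhds (∫ x in E, v x * g x)) := by
  have key : ∀ w : Lp ℝ 2 (volume.restrict E), ∫ x in E, w x * g x = inner ℝ hg.toLp w := by
    intro w
    rw [L2.inner_def]
    refine integral_congr_ae ?_
    filter_upwards [hg.coeFn_toLp] with x hx
    rw [hx]
    simp
  simp only [key]
  exact tendsto_const_nhds.inner h

theorem tendsto_integral_inner {E : Set Plane} {u : ℕ → L2Field E}
    {v : L2Field E} (h : Filter.Tendsto u Filter.atTop (nhds v)) {g : Plane → Plane}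
    (hg : MemLp g 2 (volume.restrict E)) :
    Filter.Tendsto (fun n => ∫ x in E, (inner ℝ (u n x) (g x) : ℝ)) Filter.atTop
      (nhds (∫ x in E, inner ℝ (v x) (g x))) := by
  simp only [← inner_L2Field_eq _ hg]
  exact h.inner tendsto_const_nhds

/-- If smooth gradients converge in `L²`, the Poincaré inequality makes their potentials, normalised
to mean zero on the ball, a Cauchy sequence; integration by parts passes to the limit. -/
theorem IsStarBall.exists_potential {E : Set Plane} {x₀ : Plane} {r : ℝ} (h : IsStarBall E x₀ r)
    (hE : IsOpen E) (hb : Bornology.IsBounded E) {τ : L2Field E}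
    (hτ : τ ∈ (gradSpace E).topologicalClosure) :
    ∃ v : Plane → ℝ, MemLp v 2 (volume.restrict E) ∧ HasWeakGradient E v τ := by
  obtain ⟨C, hC⟩ := h.exists_poincare hE hb
  rw [← SetLike.mem_coe, Submodule.topologicalClosure_coe, mem_closure_iff_seq_limit] at hτ
  obtain ⟨τs, hτs, hlim⟩ := hτ
  choose φ hφ hae using hτs
  have hfm : IsFiniteMeasure (volume.restrict E) := ⟨by simpa using hb.measure_lt_top⟩
  let m : (Plane → ℝ) → ℝ := fun f => ⨍ y in Metric.ball x₀ r, f y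
  have hmsub : ∀ n k, m (φ n) - m (φ k) = m (φ n - φ k) := fun n k => by
    simp only [m, setAverage_eq, Pi.sub_apply]
    rw [integral_sub
      (integrableOn_of_isBounded Metric.isBounded_ball (hφ n).1.continuous).integrable
      (integrableOn_of_isBounded Metric.isBounded_ball (hφ k).1.continuous).integrable, smul_sub]
  have hL : ∀ n, MemLp (fun x => φ n x - m (φ n)) 2 (volume.restrict E) := fun n =>
    ((hφ n).memLp E).sub (MeasureTheory.memLp_const _)
  have hdist : ∀ n k, dist (hL n).toLp (hL k).toLp ≤ C * dist (τs n) (τs k) := by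
    intro n k
    have hsub := (hφ n).sub (hφ k)
    rw [dist_edist, dist_edist, Lp.edist_toLp_toLp, Lp.edist_def]
    have e1 : eLpNorm ((fun x => φ n x - m (φ n)) - fun x => φ k x - m (φ k)) 2
          (volume.restrict E)
        = eLpNorm (fun x => (φ n - φ k) x - m (φ n - φ k)) 2 (volume.restrict E) := by
      congr 1
      ext x
      simp only [Pi.sub_apply, ← hmsub]
      ring
    have e2 : eLpNorm (⇑(τs n) - ⇑(τs k)) 2 (volume.restrict E)
        = eLpNorm (gradient (φ n - φ k)) 2 (volume.restrict E) := by
      refine eLpNorm_congr_ae ?_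
      filter_upwards [hae n, hae k] with x a b
      rw [Pi.sub_apply, a, b, sub_eq_add_neg, sub_eq_add_neg, ← neg_one_smul ℝ (φ k),
        gradient_add_apply ((hφ n).contDiff_one.differentiable one_ne_zero x)
        (((hφ k).const_smul (-1)).contDiff_one.differentiable one_ne_zero x),
        gradient_const_smul_apply _ ((hφ k).contDiff_one.differentiable one_ne_zero x),
        neg_one_smul]
    rw [e1, e2]
    refine (ENNReal.toReal_mono ?_ (hC _ hsub.contDiff_one)).trans_eq ?_
    · exact ENNReal.mul_ne_top ENNReal.coe_ne_top (hsub.memLp_gradient E).2.ne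
    · rw [ENNReal.toReal_mul, ENNReal.coe_toReal]
  have hcau : CauchySeq fun n => (hL n).toLp := by
    rw [Metric.cauchySeq_iff]
    intro ε hε
    obtain ⟨N, hN⟩ := Metric.cauchySeq_iff.1 hlim.cauchySeq (ε / (C + 1)) (by positivity)
    refine ⟨N, fun n hn k hk => (hdist n k).trans_lt ?_⟩
    calc (C : ℝ) * dist (τs n) (τs k) ≤ C * (ε / (C + 1)) := by
          gcongr; exact (hN n hn k hk).le
      _ < (C + 1) * (ε / (C + 1)) := by gcongr; linarith
      _ = ε := by field_simp
  obtain ⟨v, hv⟩ := cauchySeq_tendsto_of_complete hcau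
  refine ⟨v, Lp.memLp v, ?_⟩
  rw [hasWeakGradient_iff (Lp.memLp v) (Lp.memLp τ)]
  intro ψ hψ e
  have l1 := tendsto_integral_mul hv (hψ.memLp_fderiv E e)
  have hψe : MemLp (fun x => ψ x • e) 2 (volume.restrict E) :=
    ((hψ.1.continuous.smul continuous_const).memLp_of_hasCompactSupport
      hψ.2.1.smul_right).restrict E
  have l2 := (tendsto_integral_inner hlim hψe).neg
  simp only [real_inner_smul_right] at l2
  refine tendsto_nhds_unique l1 (l2.congr fun n => ?_)
  have hw := (hasWeakGradient_iff (hL n)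
    (memLp_of_isBounded hb (continuous_gradient (φ := fun x => φ n x - m (φ n))
      ((hφ n).contDiff_one.sub contDiff_const)))).1
    (hasWeakGradient_of_contDiff hb ((hφ n).contDiff_one.sub contDiff_const)) ψ hψ e
  have e1 : ∫ x in E, ((hL n).toLp) x * fderiv ℝ ψ x e
      = ∫ x in E, (φ n x - m (φ n)) * fderiv ℝ ψ x e :=
    integral_congr_ae (by filter_upwards [(hL n).coeFn_toLp] with x hx; rw [hx])
  rw [e1, hw]
  congr 1
  refine integral_congr_ae ?_
  filter_upwards [hae n] with x hx
  rw [hx]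
  simp only [gradient, fderiv_sub_const]

open scoped Convolution

/-! ### Density of smooth functions -/

/-- The bump has mass one, so by Jensen mollification does not increase the `L²` norm; the dilation
costs at most a factor 4 in the squared norm. -/
theorem eLpNorm_convolution_comp_le (g : ContDiffBump (0 : Plane)) {p : Plane → Plane}
    (hp : Measurable p) (c : Plane) {t : ℝ} (ht : 1 / 2 ≤ t) :
    eLpNorm (fun x => (g.normed volume ⋆[ContinuousLinearMap.lsmul ℝ ℝ, volume] p) (c + t • x)) 2
      volume ≤ 2 * eLpNorm p 2 volume := by
  set G : Plane → ENNReal := fun u => ‖g.normed volume u‖ₑ with hG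
  have hgc : Continuous (g.normed volume) := (g.contDiff_normed (n := 0)).continuous
  have hGm : Measurable G := hgc.enorm.measurable
  have hG1 : ∫⁻ u, G u = 1 := by
    have := ofReal_integral_eq_lintegral_ofReal
      (hgc.integrable_of_hasCompactSupport g.hasCompactSupport_normed)
      (Filter.Eventually.of_forall fun x => g.nonneg_normed x) (μ := volume)
    rw [g.integral_normed, ENNReal.ofReal_one] at this
    rw [this]
    exact lintegral_congr fun x => Real.enorm_of_nonneg (g.nonneg_normed x)
  set P : Plane → ENNReal := fun x => ‖p x‖ₑ ^ 2 with hP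
  have hPm : Measurable P := hp.enorm.pow_const 2
  have hpt : ∀ X : Plane,
      ‖(g.normed volume ⋆[ContinuousLinearMap.lsmul ℝ ℝ, volume] p) X‖ₑ ^ 2
        ≤ ∫⁻ u, G u * P (X - u) := by
    intro X
    have hm : Measurable fun u : Plane => ‖p (X - u)‖ₑ :=
      (hp.comp (measurable_const.sub measurable_id)).enorm
    have h1 : ‖(g.normed volume ⋆[ContinuousLinearMap.lsmul ℝ ℝ, volume] p) X‖ₑ
        ≤ ∫⁻ u, ‖p (X - u)‖ₑ ∂(volume.withDensity G) := by
      rw [lintegral_withDensity_eq_lintegral_mul _ hGm hm]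
      refine (enorm_integral_le_lintegral_enorm _).trans (le_of_eq ?_)
      refine lintegral_congr fun u => ?_
      simp [enorm_smul, hG]
    have h2 := sq_lintegral_le (volume.withDensity G) hm.aemeasurable
    rw [withDensity_apply _ MeasurableSet.univ, setLIntegral_univ, hG1, one_mul,
      lintegral_withDensity_eq_lintegral_mul _ hGm (hm.pow_const 2)] at h2
    exact (pow_le_pow_left₀ zero_le h1 2).trans h2
  have hm2 : Measurable fun q : Plane × Plane => G q.2 * P (c + t • q.1 - q.2) :=
    (hGm.comp measurable_snd).mul (hPm.comp (by fun_prop))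
  have main : ∫⁻ x, ‖(g.normed volume ⋆[ContinuousLinearMap.lsmul ℝ ℝ, volume] p)
      (c + t • x)‖ₑ ^ 2 ≤ 4 * ∫⁻ x, P x := by
    calc _ ≤ ∫⁻ x, ∫⁻ u, G u * P (c + t • x - u) := lintegral_mono fun x => hpt _
      _ = ∫⁻ u, ∫⁻ x, G u * P (c + t • x - u) := lintegral_lintegral_swap hm2.aemeasurable
      _ ≤ ∫⁻ u, G u * (4 * ∫⁻ x, P x) := by
        refine lintegral_mono fun u => ?_
        rw [lintegral_const_mul' _ _ enorm_ne_top]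
        refine mul_le_mul_right (le_trans (le_of_eq ?_)
          (lintegral_comp_add_smul_le hPm (c - u) ht)) _
        exact lintegral_congr fun x => by congr 1; abel
      _ = 4 * ∫⁻ x, P x := by rw [lintegral_mul_const _ hGm, hG1, one_mul]
  rw [eLpNorm_eq_lintegral_rpow_enorm_toReal two_ne_zero ENNReal.ofNat_ne_top,
    eLpNorm_eq_lintegral_rpow_enorm_toReal two_ne_zero ENNReal.ofNat_ne_top]
  simp only [ENNReal.toReal_ofNat, ENNReal.rpow_ofNat]
  have h4 : (2 : ENNReal) = 4 ^ (1 / 2 : ℝ) := by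
    rw [show (4 : ENNReal) = 2 ^ (2 : ℝ) by norm_num, ← ENNReal.rpow_mul]
    norm_num
  refine (ENNReal.rpow_le_rpow main (by norm_num)).trans_eq ?_
  rw [ENNReal.mul_rpow_of_nonneg _ _ (by norm_num), ← h4]

namespace IsStarBall

variable {E : Set Plane} {x₀ : Plane} {r : ℝ}

/-- Mollification at a contracted point commutes with the weak gradient. -/
theorem fderiv_convolution_eq (h : IsStarBall E x₀ r) (hE : IsOpen E)
    {v : Plane → ℝ} {τ : Plane → Plane} (hv : MemLp v 2 (volume.restrict E))
    (hτ : MemLp τ 2 (volume.restrict E)) (hw : HasWeakGradient E v τ) {t : ℝ} (ht0 : 0 ≤ t)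
    (ht1 : t < 1) (g : ContDiffBump (0 : Plane)) (hg : g.rOut < (1 - t) * r) {x : Plane}
    (hx : x ∈ closure E) (e : Plane) :
    fderiv ℝ (g.normed volume ⋆[ContinuousLinearMap.lsmul ℝ ℝ, volume] E.indicator v)
        (x₀ + t • (x - x₀)) e
      = inner ℝ ((g.normed volume ⋆[ContinuousLinearMap.lsmul ℝ ℝ, volume] E.indicator τ)
        (x₀ + t • (x - x₀))) e := by
  set X := x₀ + t • (x - x₀) with hX
  set γ : Plane → ℝ := g.normed volume with hγ
  have hγs : ContDiff ℝ ∞ γ := g.contDiff_normed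
  have hγ1 : ContDiff ℝ 1 γ := g.contDiff_normed (n := 1)
  have hγc : HasCompactSupport γ := g.hasCompactSupport_normed
  have hiv : LocallyIntegrable (E.indicator v) :=
    ((memLp_indicator_iff_restrict hE.measurableSet).2 hv).locallyIntegrable one_le_two
  have hiτ : LocallyIntegrable (E.indicator τ) :=
    ((memLp_indicator_iff_restrict hE.measurableSet).2 hτ).locallyIntegrable one_le_two
  -- The reflected bump at `X` is an admissible test function: every `z` in its support is `(1 - t)
  -- y + t x` with `y` in the star ball, hence lies in `E`. The contraction by `t` is what makes
  -- this room.
  set ψ : Plane → ℝ := fun z => γ (X - z) with hψ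
  have hψt : IsTestFunction E ψ := by
    refine ⟨hγs.comp (contDiff_const.sub contDiff_id),
      hγc.comp_homeomorph (Homeomorph.subLeft X), ?_⟩
    have : tsupport ψ = Homeomorph.subLeft X ⁻¹' tsupport γ :=
      tsupport_comp_eq_preimage γ (Homeomorph.subLeft X)
    rw [this, g.tsupport_normed_eq]
    intro z hz
    simp only [mem_preimage, Homeomorph.subLeft_apply, Metric.mem_closedBall,
      dist_zero_right] at hz
    have h1 : 0 < 1 - t := by linarith
    have hy : x₀ - (1 - t)⁻¹ • (X - z) ∈ Metric.ball x₀ r := by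
      rw [Metric.mem_ball, dist_eq_norm, sub_sub_cancel_left, norm_neg, norm_smul,
        Real.norm_of_nonneg (by positivity), inv_mul_lt_iff₀ h1]
      exact hz.trans_lt hg
    have := h.add_smul_mem hx hy ht0 ht1
    convert this using 1
    have h2 : (1 - t) • ((1 - t)⁻¹ • (X - z)) = X - z := by
      rw [smul_smul, mul_inv_cancel₀ h1.ne', one_smul]
    calc z = X - (X - z) := by abel
      _ = X - (1 - t) • ((1 - t)⁻¹ • (X - z)) := by rw [h2]
      _ = _ := by rw [hX]; module
  have hψd : ∀ z, fderiv ℝ ψ z e = - fderiv ℝ γ (X - z) e := fun z => by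
    have h1 : HasFDerivAt (fun z : Plane => X - z) (-ContinuousLinearMap.id ℝ Plane) z :=
      (hasFDerivAt_id z).const_sub X
    have h2 := ((hγ1.differentiable one_ne_zero (X - z)).hasFDerivAt).comp z h1
    have h3 : fderiv ℝ ψ z = (fderiv ℝ γ (X - z)).comp (-ContinuousLinearMap.id ℝ Plane) :=
      h2.fderiv
    rw [h3]
    simp
  have hwk := (hasWeakGradient_iff hv hτ).1 hw ψ hψt e
  have hcd : Continuous (fderiv ℝ γ) := hγ1.continuous_fderiv one_ne_zero
  rw [(hγc.hasFDerivAt_convolution_left (ContinuousLinearMap.lsmul ℝ ℝ) hγ1 hiv X).fderiv]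
  have hex := (hγc.fderiv (𝕜 := ℝ)).convolutionExists_left
    ((ContinuousLinearMap.lsmul ℝ ℝ : ℝ →L[ℝ] ℝ →L[ℝ] ℝ).precompL Plane) hcd hiv X
  have hex' := hγc.convolutionExists_left
    (ContinuousLinearMap.lsmul ℝ ℝ : ℝ →L[ℝ] Plane →L[ℝ] Plane) hγ1.continuous hiτ X
  have e1 : (fderiv ℝ γ ⋆[(ContinuousLinearMap.lsmul ℝ ℝ : ℝ →L[ℝ] ℝ →L[ℝ] ℝ).precompL Plane,
      volume] E.indicator v) X e = ∫ z in E, v z * fderiv ℝ γ (X - z) e := by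
    rw [convolution, ContinuousLinearMap.integral_apply hex.integrable,
      ← integral_sub_left_eq_self _ volume X, ← integral_indicator hE.measurableSet]
    congr 1
    ext z
    by_cases hz : z ∈ E <;> simp [hz, mul_comm]
  have e2 : inner ℝ ((γ ⋆[ContinuousLinearMap.lsmul ℝ ℝ, volume] E.indicator τ) X) e
      = ∫ z in E, ψ z * inner ℝ (τ z) e := by
    rw [convolution, real_inner_comm, ← integral_inner hex'.integrable,
      ← integral_sub_left_eq_self _ volume X, ← integral_indicator hE.measurableSet]
    congr 1
    ext z
    by_cases hz : z ∈ E <;> simp [hz, real_inner_smul_right, real_inner_comm, hψ]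
  rw [e1, e2]
  simp only [hψd, mul_neg, integral_neg] at hwk
  exact neg_injective hwk

end IsStarBall

/-- Contraction followed by mollification is uniformly bounded on `L²`, and it moves a compactly
supported continuous function little by uniform continuity; such functions are dense. -/
theorem eLpNorm_sub_convolution_le {E : Set Plane} (hE : MeasurableSet E)
    (hb : Bornology.IsBounded E) (x₀ : Plane) {r : ℝ} (hr : 0 < r) {h : Plane → Plane}
    (hm : Measurable h) (hL : MemLp h 2 volume) {ε : ℝ} (hε : 0 < ε) :
    ∃ t : ℝ, 1 / 2 ≤ t ∧ t < 1 ∧ ∃ g : ContDiffBump (0 : Plane), g.rOut < (1 - t) * r ∧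
      eLpNorm (h - fun x => (g.normed volume ⋆[ContinuousLinearMap.lsmul ℝ ℝ, volume] h)
        ((1 - t) • x₀ + t • x)) 2 (volume.restrict E) < ENNReal.ofReal ε := by
  obtain ⟨k, hkc, hke, hk, hkL⟩ := hL.exists_hasCompactSupport_eLpNorm_sub_le
    ENNReal.ofNat_ne_top (ε := ENNReal.ofReal (ε / 8)) (by simpa using hε)
  set V : ENNReal := volume E ^ (2 : ENNReal).toReal⁻¹ with hV
  have hVtop : V ≠ ⊤ := ENNReal.rpow_ne_top_of_nonneg (by norm_num) hb.measure_lt_top.ne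
  -- Chosen so that a uniform error `2 * η` has `L²(E)` norm at most `ε / 8`; the three errors then
  -- add up to `ε / 2`.
  set η : ℝ := ε / (16 * (V.toReal + 1)) with hη
  have hη0 : 0 < η := by positivity
  obtain ⟨δ, hδ, hunif⟩ := Metric.uniformContinuous_iff.1
    (hkc.uniformContinuous_of_continuous hk) η hη0
  obtain ⟨R, hR⟩ := hb.subset_closedBall x₀
  -- `s` is `1 - t`: at most `1/2` for the norm bound, and so small that the contraction moves
  -- points of `E` by less than `δ`.
  set s : ℝ := min (1 / 2) (δ / (2 * (|R| + 1))) with hs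
  have hs0 : 0 < s := by positivity
  have hsR : s * |R| < δ := by
    calc s * |R| ≤ δ / (2 * (|R| + 1)) * |R| := by gcongr; exact min_le_right _ _
      _ < δ := by
        rw [div_mul_eq_mul_div, div_lt_iff₀ (by positivity)]
        nlinarith [abs_nonneg R]
  have hs2 : s ≤ 1 / 2 := min_le_left _ _
  set ρ : ℝ := min δ (s * r / 2) with hρ
  have hρ0 : 0 < ρ := by positivity
  let g : ContDiffBump (0 : Plane) := ⟨ρ / 2, ρ, by positivity, by linarith⟩
  have hgρ : g.rOut = ρ := rfl
  refine ⟨1 - s, by linarith, by linarith, g, ?_, ?_⟩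
  · rw [hgρ, sub_sub_cancel]
    have : 0 < s * r := by positivity
    linarith [min_le_right δ (s * r / 2)]
  set T : (Plane → Plane) → Plane → Plane := fun p x =>
    (g.normed volume ⋆[ContinuousLinearMap.lsmul ℝ ℝ, volume] p)
      ((1 - (1 - s)) • x₀ + (1 - s) • x) with hT
  have hgc : Continuous (g.normed volume) := (g.contDiff_normed (n := 0)).continuous
  have hmem : MemLp (h - k) 2 volume := hL.sub hkL
  have hcont : ∀ p : Plane → Plane, MemLp p 2 volume → Continuous (T p) := fun p hp =>
    (g.hasCompactSupport_normed.continuous_convolution_left _ hgc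
      (hp.locallyIntegrable one_le_two)).comp (by fun_prop)
  have hex : ∀ p : Plane → Plane, MemLp p 2 volume → ConvolutionExists (g.normed volume) p
      (ContinuousLinearMap.lsmul ℝ ℝ) volume := fun p hp =>
    g.hasCompactSupport_normed.convolutionExists_left _ hgc (hp.locallyIntegrable one_le_two)
  have hsplit : h - T h = (h - k) + ((k - T k) - T (h - k)) := by
    have h1 : T h = T k + T (h - k) := by
      have := (hex k hkL).distrib_add (hex _ hmem)
      rw [add_sub_cancel] at this
      ext1 x
      simp only [hT, this, Pi.add_apply]
    rw [h1]
    abel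
  have hpt : ∀ x ∈ E, ‖(k - T k) x‖ ≤ 2 * η := by
    intro x hx
    set X : Plane := (1 - (1 - s)) • x₀ + (1 - s) • x with hX
    have hXx : dist X x < δ := by
      have : X - x = s • (x₀ - x) := by rw [hX]; module
      rw [dist_eq_norm, this, norm_smul, Real.norm_of_nonneg hs0.le, ← dist_eq_norm, dist_comm]
      refine lt_of_le_of_lt ?_ hsR
      gcongr
      exact (hR hx).trans (le_abs_self R)
    have h1 : dist (T k x) (k X) ≤ η :=
      ContDiffBump.dist_normed_convolution_le hk.aestronglyMeasurable fun y hy =>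
        (hunif (lt_of_lt_of_le hy (min_le_left _ _))).le
    rw [Pi.sub_apply, ← dist_eq_norm, dist_comm]
    linarith [dist_triangle (T k x) (k X) (k x), (hunif hXx).le]
  have b1 : eLpNorm (h - k) 2 (volume.restrict E) ≤ ENNReal.ofReal (ε / 8) :=
    (eLpNorm_mono_measure _ Measure.restrict_le_self).trans hke
  have b2 : eLpNorm (k - T k) 2 (volume.restrict E) ≤ ENNReal.ofReal (ε / 8) := by
    refine (eLpNorm_le_of_ae_bound (C := 2 * η)
      ((ae_restrict_mem hE).mono hpt)).trans ?_
    rw [Measure.restrict_apply_univ, ← hV, ← ENNReal.ofReal_toReal hVtop,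
      ← ENNReal.ofReal_mul ENNReal.toReal_nonneg]
    refine ENNReal.ofReal_le_ofReal ?_
    have hη1 : (V.toReal + 1) * (2 * η) = ε / 8 := by rw [hη]; field_simp; norm_num
    nlinarith [ENNReal.toReal_nonneg (a := V)]
  have b3 : eLpNorm (T (h - k)) 2 (volume.restrict E) ≤ 2 * ENNReal.ofReal (ε / 8) := by
    refine (eLpNorm_mono_measure _ Measure.restrict_le_self).trans ?_
    refine (eLpNorm_convolution_comp_le g (hm.sub hk.measurable) _ (by linarith)).trans ?_
    gcongr
  have m1 : AEStronglyMeasurable (h - k) (volume.restrict E) := (hmem.restrict E).1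
  have m2 : AEStronglyMeasurable (k - T k) (volume.restrict E) :=
    (hk.sub (hcont k hkL)).aestronglyMeasurable
  have m3 : AEStronglyMeasurable (T (h - k)) (volume.restrict E) :=
    (hcont _ hmem).aestronglyMeasurable
  change eLpNorm (h - T h) 2 (volume.restrict E) < ENNReal.ofReal ε
  calc eLpNorm (h - T h) 2 (volume.restrict E)
      ≤ eLpNorm (h - k) 2 (volume.restrict E) + (eLpNorm (k - T k) 2 (volume.restrict E)
          + eLpNorm (T (h - k)) 2 (volume.restrict E)) := by
        rw [hsplit]
        refine (eLpNorm_add_le m1 (m2.sub m3) one_le_two).trans ?_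
        gcongr
        exact eLpNorm_sub_le m2 m3 one_le_two
    _ ≤ ENNReal.ofReal (ε / 8) + (ENNReal.ofReal (ε / 8) + 2 * ENNReal.ofReal (ε / 8)) := by
        gcongr
    _ = ENNReal.ofReal (ε / 2) := by
        rw [show (2 : ENNReal) = ENNReal.ofReal 2 by simp, ← ENNReal.ofReal_mul (by norm_num),
          ← ENNReal.ofReal_add (by positivity) (by positivity),
          ← ENNReal.ofReal_add (by positivity) (by positivity)]
        congr 1; ring
    _ < ENNReal.ofReal ε := (ENNReal.ofReal_lt_ofReal_iff hε).2 (by linarith)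

namespace IsStarBall

variable {E : Set Plane} {x₀ : Plane} {r : ℝ}

/-- Mollify the potential, extended by zero, and evaluate at the contracted point: there the
mollifier sees only the inside of `E`, so the gradient is `t` times the mollified field, which is
close to `τ`. -/
theorem mem_closure_gradSpace_of_measurable (h : IsStarBall E x₀ r) (hE : IsOpen E)
    (hb : Bornology.IsBounded E) {v : Plane → ℝ} {τ : Plane → Plane}
    (hv : MemLp v 2 (volume.restrict E)) (hτ : MemLp τ 2 (volume.restrict E))
    (hm : Measurable τ) (hw : HasWeakGradient E v τ) :
    hτ.toLp ∈ (gradSpace E).topologicalClosure := by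
  rw [← SetLike.mem_coe, Submodule.topologicalClosure_coe, Metric.mem_closure_iff]
  intro ε hε
  have hL : MemLp (E.indicator τ) 2 volume := (memLp_indicator_iff_restrict hE.measurableSet).2 hτ
  have hiv : LocallyIntegrable (E.indicator v) :=
    ((memLp_indicator_iff_restrict hE.measurableSet).2 hv).locallyIntegrable one_le_two
  have hcv : HasCompactSupport (E.indicator v) :=
    HasCompactSupport.intro hb.isCompact_closure fun x hx =>
      indicator_of_notMem (fun hx' => hx (subset_closure hx')) _
  obtain ⟨t, ht, ht1, g, hg, hlt⟩ := eLpNorm_sub_convolution_le hE.measurableSet hb x₀ h.pos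
    (hm.indicator hE.measurableSet) hL hε
  have ht0 : t ≠ 0 := by linarith
  set W : Plane → ℝ :=
    g.normed volume ⋆[ContinuousLinearMap.lsmul ℝ ℝ, volume] E.indicator v with hW
  have hWs : ContDiff ℝ ∞ W :=
    g.hasCompactSupport_normed.contDiff_convolution_left _ g.contDiff_normed hiv
  set w : Plane → ℝ := fun x => W ((1 - t) • x₀ + t • x) with hwdef
  have hwt : IsTestFunction univ w := by
    refine ⟨hWs.comp (by fun_prop), ?_, subset_univ _⟩
    exact (HasCompactSupport.convolution _ g.hasCompactSupport_normed hcv).comp_homeomorph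
      ((Homeomorph.smulOfNeZero t ht0).trans (Homeomorph.addLeft ((1 - t) • x₀)))
  have hgrad : ∀ x ∈ E, t⁻¹ • gradient w x =
      (g.normed volume ⋆[ContinuousLinearMap.lsmul ℝ ℝ, volume] E.indicator τ)
        ((1 - t) • x₀ + t • x) := by
    intro x hx
    refine ext_inner_right ℝ fun e => ?_
    have hX : (1 - t) • x₀ + t • x = x₀ + t • (x - x₀) := by module
    have h1 : HasFDerivAt (fun x : Plane => (1 - t) • x₀ + t • x)
        (t • ContinuousLinearMap.id ℝ Plane) x :=
      ((hasFDerivAt_id x).const_smul t).const_add _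
    have h2 : fderiv ℝ w x = (fderiv ℝ W ((1 - t) • x₀ + t • x)).comp
        (t • ContinuousLinearMap.id ℝ Plane) :=
      ((hWs.differentiable (by simp) _).hasFDerivAt.comp x h1).fderiv
    rw [real_inner_smul_left, inner_gradient_real, h2, hX,
      ← h.fderiv_convolution_eq hE hv hτ hw (by linarith) ht1 g hg (subset_closure hx)]
    simp [ht0, hW]
  -- The factor `t⁻¹` undoes the chain rule factor of the contraction.
  refine ⟨t⁻¹ • (hwt.memLp_gradient E).toLp,
    Submodule.smul_mem _ _ (hwt.toLp_gradient_mem E), ?_⟩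
  rw [← ENNReal.ofReal_lt_ofReal_iff hε, ← edist_dist, Lp.edist_def]
  refine lt_of_eq_of_lt (eLpNorm_congr_ae ?_) hlt
  filter_upwards [hτ.coeFn_toLp, (hwt.memLp_gradient E).coeFn_toLp,
    Lp.coeFn_smul t⁻¹ (hwt.memLp_gradient E).toLp, ae_restrict_mem hE.measurableSet]
    with x a b c hx
  rw [Pi.sub_apply, a, c, Pi.smul_apply, b, hgrad x hx, Pi.sub_apply, indicator_of_mem hx]

/-- Smooth functions are dense among weak gradients. -/
theorem mem_closure_gradSpace (h : IsStarBall E x₀ r) (hE : IsOpen E)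
    (hb : Bornology.IsBounded E) {v : Plane → ℝ} (τ : L2Field E)
    (hv : MemLp v 2 (volume.restrict E)) (hw : HasWeakGradient E v τ) :
    τ ∈ (gradSpace E).topologicalClosure := by
  have hm := (Lp.stronglyMeasurable τ).measurable
  have := h.mem_closure_gradSpace_of_measurable hE hb hv (Lp.memLp τ) hm hw
  rwa [Lp.toLp_coeFn] at this

end IsStarBall

/-! ### Cut-off functions and means of polynomials -/

/-- Normal traces are tested with compactly supported functions only; this makes polynomials
available as tests. -/
theorem exists_cutoff {E : Set Plane} (hb : Bornology.IsBounded E) {f : Plane → ℝ}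
    (hf : ContDiff ℝ ∞ f) : ∃ φ : Plane → ℝ, IsTestFunction univ φ ∧
      ∀ x ∈ closure E, φ x = f x ∧ gradient φ x = gradient f x := by
  obtain ⟨R, hR⟩ := hb.closure.subset_closedBall 0
  let g : ContDiffBump (0 : Plane) := ⟨|R| + 1, |R| + 2, by positivity, by linarith⟩
  refine ⟨fun x => g x * f x, ⟨g.contDiff.mul hf, g.hasCompactSupport.mul_right,
    subset_univ _⟩, fun x hx => ?_⟩
  have hxb : x ∈ Metric.ball (0 : Plane) g.rIn :=
    lt_of_le_of_lt (hR hx) (lt_of_le_of_lt (le_abs_self R) (lt_add_one |R|))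
  have h1 : (fun x => g x * f x) =ᶠ[nhds x] f := by
    filter_upwards [g.eventuallyEq_one_of_mem_ball hxb] with y hy
    rw [hy, Pi.one_apply, one_mul]
  exact ⟨h1.eq_of_nhds, h1.gradient_eq⟩

theorem segMean_congr {p q : Plane} {f g : Plane → ℝ} (h : ∀ x ∈ segment ℝ p q, f x = g x) :
    segMean p q f = segMean p q g := by
  refine intervalIntegral.integral_congr fun t ht => ?_
  rw [uIcc_of_le zero_le_one] at ht
  exact h _ (segment_eq_image_lineMap ℝ p q ▸ mem_image_of_mem _ ht)

theorem segMean_const_mul (p q : Plane) (c : ℝ) (f : Plane → ℝ) :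
    segMean p q (fun x => c * f x) = c * segMean p q f :=
  intervalIntegral.integral_const_mul _ _

theorem segMean_add (p q : Plane) {f g : Plane → ℝ} (hf : Continuous f) (hg : Continuous g) :
    segMean p q (fun x => f x + g x) = segMean p q f + segMean p q g :=
  intervalIntegral.integral_add
    ((continuous_segMean_integrand hf p q).intervalIntegrable _ _)
    ((continuous_segMean_integrand hg p q).intervalIntegrable _ _)

theorem segMean_const (p q : Plane) (c : ℝ) : segMean p q (fun _ => c) = c := by
  simp [segMean]

theorem integral_quadratic (α β κ : ℝ) :
    ∫ t in (0 : ℝ)..1, (α + β * t + κ * t ^ 2) = α + β / 2 + κ / 3 := by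
  have h : ∀ t ∈ uIcc (0 : ℝ) 1, HasDerivAt (fun t : ℝ => α * t + β / 2 * t ^ 2 + κ / 3 * t ^ 3)
      (α + β * t + κ * t ^ 2) t := fun t _ => by
    have := (((hasDerivAt_id t).const_mul α).add ((hasDerivAt_pow 2 t).const_mul (β / 2))).add
      ((hasDerivAt_pow 3 t).const_mul (κ / 3))
    exact this.congr_deriv (by norm_num; ring)
  rw [intervalIntegral.integral_eq_sub_of_hasDerivAt h
    ((by fun_prop : Continuous fun t : ℝ => α + β * t + κ * t ^ 2).intervalIntegrable _ _)]
  ring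

theorem inner_lineMap (a p q : Plane) (t : ℝ) :
    (inner ℝ a (AffineMap.lineMap p q t) : ℝ)
      = inner ℝ a p + (inner ℝ a q - inner ℝ a p) * t := by
  rw [AffineMap.lineMap_apply_module, inner_add_right, real_inner_smul_right,
    real_inner_smul_right]
  ring

theorem segMean_inner (p q a : Plane) :
    segMean p q (fun x => inner ℝ a x) = (inner ℝ a p + inner ℝ a q) / 2 := by
  simp only [segMean, inner_lineMap]
  have := integral_quadratic (inner ℝ a p) (inner ℝ a q - inner ℝ a p) 0
  simp only [zero_mul, add_zero, zero_div] at this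
  rw [this]
  ring

theorem segMean_inner_mul_inner (p q a b : Plane) :
    segMean p q (fun x => inner ℝ a x * inner ℝ b x)
      = (2 * (inner ℝ a p * inner ℝ b p) + 2 * (inner ℝ a q * inner ℝ b q)
        + inner ℝ a p * inner ℝ b q + inner ℝ a q * inner ℝ b p) / 6 := by
  simp only [segMean, inner_lineMap]
  have := integral_quadratic (inner ℝ a p * inner ℝ b p)
    (inner ℝ a p * (inner ℝ b q - inner ℝ b p) + inner ℝ b p * (inner ℝ a q - inner ℝ a p))
    ((inner ℝ a q - inner ℝ a p) * (inner ℝ b q - inner ℝ b p))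
  rw [show (2 * (inner ℝ a p * inner ℝ b p) + 2 * (inner ℝ a q * inner ℝ b q)
        + inner ℝ a p * inner ℝ b q + inner ℝ a q * inner ℝ b p) / 6 =
      (inner ℝ a p * inner ℝ b p : ℝ) + (inner ℝ a p * (inner ℝ b q - inner ℝ b p)
        + inner ℝ b p * (inner ℝ a q - inner ℝ a p)) / 2
        + ((inner ℝ a q - inner ℝ a p) * (inner ℝ b q - inner ℝ b p)) / 3 by ring, ← this]
  congr 1
  ext t
  ring

namespace Quadrilateral

variable {Q : Quadrilateral} {x₀ : Plane} {r : ℝ}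

theorem volume_E_ne_zero (Q : Quadrilateral) : volume Q.E ≠ 0 :=
  (Q.isOpen_E.measure_pos volume Q.isConnected_E.nonempty).ne'

theorem volume_E_ne_top (Q : Quadrilateral) : volume Q.E ≠ ⊤ :=
  Q.isBounded_E.measure_lt_top.ne

/-! ### Normal traces -/

/-- The fundamental lemma of the calculus of variations; it identifies the unspecified divergence
inside `HasNormalTrace` with the constant one. -/
theorem weakDivergence_ae_eq {τ : Plane → Plane} {d : Plane → ℝ} {δ : ℝ}
    (hd : MemLp d 2 (volume.restrict Q.E)) (h₁ : HasWeakDivergence Q.E τ d)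
    (h₂ : HasWeakDivergence Q.E τ fun _ => δ) : d =ᵐ[volume.restrict Q.E] fun _ => δ := by
  have hfm : IsFiniteMeasure (volume.restrict Q.E) := ⟨by simpa using Q.volume_E_ne_top.lt_top⟩
  have hsub : MemLp (fun x => d x - δ) 2 (volume.restrict Q.E) := hd.sub (Q.memLp_const δ)
  have key := Q.isOpen_E.ae_eq_zero_of_integral_contDiff_smul_eq_zero (μ := volume)
    (f := fun x => d x - δ)
    (IntegrableOn.locallyIntegrableOn (hsub.integrable one_le_two)) ?_
  · rw [Filter.EventuallyEq, ae_restrict_iff' Q.isOpen_E.measurableSet]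
    filter_upwards [key] with x hx hxE
    linarith [hx hxE]
  · intro φ h1 h2 h3
    have hφ : IsTestFunction Q.E φ := ⟨h1, h2, h3⟩
    rw [← setIntegral_eq_integral_of_forall_compl_eq_zero (s := Q.E) fun x hx => by
      rw [hφ.eq_zero hx, zero_smul]]
    have e : ∫ x in Q.E, d x * φ x = ∫ x in Q.E, δ * φ x :=
      neg_injective ((h₁ φ hφ).symm.trans (h₂ φ hφ))
    simp only [smul_eq_mul, mul_comm (φ _), sub_mul]
    rw [integral_sub (integrable_mul_of_memLp hd (hφ.memLp _))
      (integrable_mul_of_memLp (Q.memLp_const δ) (hφ.memLp _)), e, sub_self]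

theorem weakDivergence_const_unique {τ : Plane → Plane} {δ ε : ℝ}
    (h₁ : HasWeakDivergence Q.E τ fun _ => δ) (h₂ : HasWeakDivergence Q.E τ fun _ => ε) :
    δ = ε := by
  have h := weakDivergence_ae_eq (Q.memLp_const δ) h₁ h₂
  have hne : (ae (volume.restrict Q.E)).NeBot := by
    rw [ae_neBot, Ne, Measure.restrict_eq_zero]
    exact Q.volume_E_ne_zero
  obtain ⟨x, hx⟩ := h.exists
  exact hx

theorem HasNormalTrace.green {τ : Plane → Plane} {c : Fin 4 → ℝ} {δ : ℝ}
    (h : Q.HasNormalTrace τ fun j _ => c j) (hδ : HasWeakDivergence Q.E τ fun _ => δ)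
    {φ : Plane → ℝ} (hφ : IsTestFunction univ φ) :
    (∫ x in Q.E, inner ℝ (τ x) (gradient φ x)) + δ * ∫ x in Q.E, φ x
      = ∑ j, Q.edgeLength j * c j * segMean (Q.vertex j) (Q.vertex (j + 1)) φ := by
  obtain ⟨d, hd, hd', h⟩ := h
  have hae := weakDivergence_ae_eq hd hd' hδ
  have e : ∫ x in Q.E, d x * φ x = δ * ∫ x in Q.E, φ x := by
    rw [← integral_const_mul]
    exact integral_congr_ae (by filter_upwards [hae] with x hx; rw [hx])
  rw [← e, h φ hφ]
  refine Finset.sum_congr rfl fun j _ => ?_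
  rw [edgeIntegral_const_mul, edgeIntegral_eq]
  ring

/-- Green's formula with a test function equal to 1 on the closure of `E`. -/
theorem HasNormalTrace.divergence_eq {τ : Plane → Plane} {c : Fin 4 → ℝ} {δ : ℝ}
    (h : Q.HasNormalTrace τ fun j _ => c j) (hδ : HasWeakDivergence Q.E τ fun _ => δ) :
    δ * volume.real Q.E = ∑ j, Q.edgeLength j * c j := by
  obtain ⟨φ, hφ, he⟩ := exists_cutoff Q.isBounded_E (f := fun _ => 1) contDiff_const
  have h1 := h.green hδ hφ
  have e1 : ∫ x in Q.E, (inner ℝ (τ x) (gradient φ x) : ℝ) = 0 :=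
    (setIntegral_congr_fun Q.isOpen_E.measurableSet fun x hx => by
      simp only [(he x (subset_closure hx)).2, gradient_fun_const, inner_zero_right]).trans
      (integral_zero _ _)
  have e2 : ∫ x in Q.E, φ x = volume.real Q.E := by
    rw [setIntegral_congr_fun Q.isOpen_E.measurableSet fun x hx => (he x (subset_closure hx)).1]
    simp
  rw [e1, e2, zero_add] at h1
  rw [h1]
  refine Finset.sum_congr rfl fun j _ => ?_
  rw [segMean_congr fun x hx => (he x (frontier_subset_closure
    (Q.segment_subset_frontier j hx))).1, segMean_const, mul_one]

theorem weakDivergence_of_green {τ : Plane → Plane} {m : Fin 4 → ℝ} {δ : ℝ}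
    (h : ∀ φ, IsTestFunction univ φ →
      (∫ x in Q.E, inner ℝ (τ x) (gradient φ x)) + ∫ x in Q.E, δ * φ x
        = ∑ j, m j * segMean (Q.vertex j) (Q.vertex (j + 1)) φ) :
    HasWeakDivergence Q.E τ fun _ => δ := by
  intro φ hφ
  have h1 := h φ (hφ.mono (subset_univ _))
  have h2 : ∀ j, segMean (Q.vertex j) (Q.vertex (j + 1)) φ = 0 := fun j => by
    rw [segMean_congr (g := fun _ => 0) fun x hx => hφ.eq_zero fun hxE =>
      Q.disjoint_frontier.le_bot ⟨hxE, Q.segment_subset_frontier j hx⟩, segMean_const]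
  simp only [h2, mul_zero, Finset.sum_const_zero] at h1
  linarith

theorem normalTrace_of_green {τ : Plane → Plane} {m : Fin 4 → ℝ} {δ : ℝ}
    (h : ∀ φ, IsTestFunction univ φ →
      (∫ x in Q.E, inner ℝ (τ x) (gradient φ x)) + ∫ x in Q.E, δ * φ x
        = ∑ j, m j * segMean (Q.vertex j) (Q.vertex (j + 1)) φ) :
    Q.HasNormalTrace τ fun j _ => m j / Q.edgeLength j := by
  refine ⟨fun _ => δ, Q.memLp_const δ, weakDivergence_of_green h, fun φ hφ => ?_⟩
  rw [h φ hφ]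
  refine Finset.sum_congr rfl fun j _ => ?_
  have := (Q.edgeLength_pos j).ne'
  rw [edgeIntegral_const_mul, edgeIntegral_eq]
  field_simp

/-- Common membership criterion for Raviart-Thomas fields and `θ`, in terms of total edge fluxes
`m`. Test functions supported in `E` lose the boundary terms, so the same identity also yields the
divergence. -/
theorem memVEM_of_green {τ : Plane → Plane} {m : Fin 4 → ℝ} {δ : ℝ} {v : Plane → ℝ}
    (hτ : MemLp τ 2 (volume.restrict Q.E)) (hv : MemLp v 2 (volume.restrict Q.E))
    (hw : HasWeakGradient Q.E v τ) (h : ∀ φ, IsTestFunction univ φ →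
      (∫ x in Q.E, inner ℝ (τ x) (gradient φ x)) + ∫ x in Q.E, δ * φ x
        = ∑ j, m j * segMean (Q.vertex j) (Q.vertex (j + 1)) φ) : Q.MemVEM τ :=
  ⟨⟨hτ, _, Q.memLp_const δ, weakDivergence_of_green h⟩, ⟨v, ⟨hv, τ, hτ, hw⟩, hw⟩,
    ⟨_, normalTrace_of_green h⟩, ⟨δ, weakDivergence_of_green h⟩⟩

/-- The total flux is zero, hence so is the divergence, and Green's formula makes `τ` orthogonal to
smooth gradients. As a weak gradient it lies in their closure, so it is orthogonal to itself. -/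
theorem eq_zero_of_normalTrace (h : IsStarBall Q.E x₀ r) {τ : L2Field Q.E} (hτ : τ ∈ Q.vemSpace)
    (h0 : Q.HasNormalTrace τ fun _ _ => 0) : τ = 0 := by
  have hV : Q.MemVEM τ := hτ
  obtain ⟨δ, hδ⟩ := hV.divergence
  obtain ⟨v, hv, hw⟩ := hV.potential
  have hδ0 : δ = 0 := by
    have h1 := h0.divergence_eq (c := fun _ => 0) hδ
    have h2 : volume.real Q.E ≠ 0 :=
      ENNReal.toReal_ne_zero.2 ⟨Q.volume_E_ne_zero, Q.volume_E_ne_top⟩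
    simpa [h2] using h1
  have hmem := h.mem_closure_gradSpace Q.isOpen_E Q.isBounded_E τ hv.1 hw
  have horth : τ ∈ (gradSpace Q.E)ᗮ := by
    rw [Submodule.mem_orthogonal']
    rintro g ⟨φ, hφ, hg⟩
    have e : inner ℝ τ g = ∫ x in Q.E, inner ℝ (τ x) (gradient φ x) := by
      rw [L2.inner_def]
      exact integral_congr_ae (by filter_upwards [hg] with x hx; rw [hx])
    have := h0.green (c := fun _ => 0) hδ hφ
    rw [e]
    simpa [hδ0] using this
  rw [← Submodule.orthogonal_closure] at horth
  exact inner_self_eq_zero.1 ((Submodule.mem_orthogonal' _ _).1 horth τ hmem)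

/-! ### Raviart-Thomas fields -/

/-- Green's formula for the components of `φ x • (a + c • x)`. The normal component of `x` is
constant along a line, so the value at vertex `j` serves the whole edge. -/
theorem green_raviartThomas (h : IsStarBall Q.E x₀ r) (a : Plane) (c : ℝ) {φ : Plane → ℝ}
    (hφ : IsTestFunction univ φ) :
    (∫ x in Q.E, inner ℝ (a + c • x) (gradient φ x)) + ∫ x in Q.E, 2 * c * φ x
      = ∑ j, cross2 (a + c • Q.vertex j) (Q.vertex (j + 1) - Q.vertex j) *
          segMean (Q.vertex j) (Q.vertex (j + 1)) φ := by
  have hφ1 := hφ.contDiff_one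
  have hφc := hφ1.continuous
  have hfc : Continuous (fderiv ℝ φ) := hφ1.continuous_fderiv one_ne_zero
  have hρ : ∀ i : Fin 2, ContDiff ℝ 1 fun x : Plane => a i + c * x i := fun i => by fun_prop
  have hG : ∀ i : Fin 2, ContDiff ℝ 1 fun x : Plane => φ x * (a i + c * x i) :=
    fun i => hφ1.mul (hρ i)
  have hd : ∀ (i : Fin 2) (x : Plane), fderiv ℝ (fun x : Plane => φ x * (a i + c * x i)) x
      (EuclideanSpace.single i 1)
      = (a i + c * x i) * fderiv ℝ φ x (EuclideanSpace.single i 1) + c * φ x := fun i x => by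
    have h1 : HasFDerivAt (fun x : Plane => a i + c * x i)
        (c • (EuclideanSpace.proj i : Plane →L[ℝ] ℝ)) x :=
      (((EuclideanSpace.proj i : Plane →L[ℝ] ℝ).hasFDerivAt).const_mul c).const_add _
    have h2 : fderiv ℝ (fun x : Plane => φ x * (a i + c * x i)) x = _ :=
      ((hφ1.differentiable one_ne_zero x).hasFDerivAt.mul h1).fderiv
    rw [h2]
    simp
    ring
  have hdec : ∀ y : Plane, y = y 0 • EuclideanSpace.single 0 (1 : ℝ)
      + y 1 • EuclideanSpace.single 1 (1 : ℝ) := fun y => by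
    apply plane_ext <;> simp
  have hpt : ∀ x : Plane, inner ℝ (a + c • x) (gradient φ x) + 2 * c * φ x
      = fderiv ℝ (fun x : Plane => φ x * (a 0 + c * x 0)) x (EuclideanSpace.single 0 1)
        + fderiv ℝ (fun x : Plane => φ x * (a 1 + c * x 1)) x (EuclideanSpace.single 1 1) := by
    intro x
    rw [hd, hd, real_inner_gradient]
    conv_lhs => rw [hdec (a + c • x)]
    simp only [map_add, map_smul, smul_eq_mul, PiLp.add_apply, PiLp.smul_apply]
    ring
  have hI : ∀ {f : Plane → ℝ}, Continuous f → Integrable f (volume.restrict Q.E) :=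
    fun hf => integrableOn_of_isBounded Q.isBounded_E hf
  have hfd : ∀ i : Fin 2, Continuous fun x : Plane =>
      fderiv ℝ (fun x : Plane => φ x * (a i + c * x i)) x (EuclideanSpace.single i 1) :=
    fun i => ((hG i).continuous_fderiv one_ne_zero).clm_apply continuous_const
  rw [← integral_add (hI (by simp only [real_inner_gradient]; fun_prop)) (hI (by fun_prop)),
    integral_congr_ae (Filter.Eventually.of_forall hpt), integral_add (hI (hfd 0)) (hI (hfd 1)),
    integral_fderiv h (hG 0), integral_fderiv h (hG 1), ← Finset.sum_add_distrib]
  refine Finset.sum_congr rfl fun j _ => ?_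
  rw [← segMean_const_mul, ← segMean_const_mul, ← segMean_const_mul]
  refine (segMean_add _ _ (by fun_prop) (by fun_prop)).symm.trans ?_
  refine segMean_congr fun x hx => ?_
  rw [segment_eq_image_lineMap] at hx
  obtain ⟨t, -, rfl⟩ := hx
  simp only [AffineMap.lineMap_apply_module, cross2, PiLp.add_apply, PiLp.smul_apply,
    PiLp.sub_apply, smul_eq_mul, PiLp.single_apply]
  simp
  ring

theorem hasWeakGradient_raviartThomas (Q : Quadrilateral) (a : Plane) (c : ℝ) :
    HasWeakGradient Q.E (fun x => inner ℝ a x + c / 2 * inner ℝ x x) fun x => a + c • x := by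
  have hs : ContDiff ℝ 1 fun x : Plane => (inner ℝ a x + c / 2 * inner ℝ x x : ℝ) :=
    (contDiff_const.inner ℝ contDiff_id).add
      (contDiff_const.mul (contDiff_id.inner ℝ contDiff_id))
  convert hasWeakGradient_of_contDiff Q.isBounded_E hs using 1
  ext1 x
  refine ext_inner_right ℝ fun e => ?_
  have h1 : HasFDerivAt (fun x : Plane => (inner ℝ a x : ℝ)) (innerSL ℝ a) x :=
    (innerSL ℝ a).hasFDerivAt
  have h2 := (hasFDerivAt_id x).inner ℝ (hasFDerivAt_id x)
  have h3 := h1.add (h2.const_mul (c / 2))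
  simp only [id] at h3
  have h4 := h3.fderiv
  rw [inner_gradient_real]
  erw [h4]
  simp only [inner_add_left, real_inner_smul_left, add_apply,
    innerSL_apply_apply, smul_apply, ContinuousLinearMap.comp_apply,
    ContinuousLinearMap.prod_apply, ContinuousLinearMap.id_apply, fderivInnerCLM_apply,
    real_inner_comm x e, smul_eq_mul]
  ring

theorem memLp_raviartThomas (Q : Quadrilateral) (a : Plane) (c : ℝ) :
    MemLp (fun x : Plane => a + c • x) 2 (volume.restrict Q.E) :=
  memLp_of_isBounded Q.isBounded_E (by fun_prop)

theorem memVEM_raviartThomas (h : IsStarBall Q.E x₀ r) (a : Plane) (c : ℝ) :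
    Q.MemVEM fun x => a + c • x :=
  memVEM_of_green (Q.memLp_raviartThomas a c) (memLp_of_isBounded Q.isBounded_E (by fun_prop))
    (Q.hasWeakGradient_raviartThomas a c) fun _ hφ => green_raviartThomas h a c hφ

theorem raviartThomas_le (h : IsStarBall Q.E x₀ r) : Q.raviartThomas ≤ Q.vemSpace := by
  rintro τ ⟨a, c, hτ⟩
  exact (memVEM_raviartThomas h a c).congr hτ.symm

theorem weakDivergence_raviartThomas (h : IsStarBall Q.E x₀ r) (a : Plane) (c : ℝ) :
    HasWeakDivergence Q.E (fun x => a + c • x) fun _ => 2 * c :=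
  weakDivergence_of_green fun _ hφ => green_raviartThomas h a c hφ

end Quadrilateral

namespace Quadrilateral

variable {Q : Quadrilateral} {x₀ : Plane} {r : ℝ}

/-! ### The hourglass function -/

/-- The piecewise constant field has the right fluxes but need not be a gradient. Its projection
onto the closed space of gradients differs from it by something orthogonal to all smooth gradients,
so Green's formula survives. -/
theorem exists_isHourglass (h : IsStarBall Q.E x₀ r) : ∃ θ, Q.IsHourglass θ := by
  obtain ⟨σ, hσ, hσg⟩ := exists_piecewise_field h
  let K := (gradSpace Q.E).topologicalClosure
  have hK : CompleteSpace K := (gradSpace Q.E).isClosed_topologicalClosure.completeSpace_coe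
  let θ : L2Field Q.E := K.starProjection hσ.toLp
  have hθK : θ ∈ K := Submodule.starProjection_apply_mem K _
  obtain ⟨v, hv, hw⟩ := h.exists_potential Q.isOpen_E Q.isBounded_E hθK
  have hgreen : ∀ φ, IsTestFunction univ φ →
      (∫ x in Q.E, inner ℝ (θ x) (gradient φ x)) + ∫ x in Q.E, 0 * φ x
        = ∑ j, edgeSign j * segMean (Q.vertex j) (Q.vertex (j + 1)) φ := by
    intro φ hφ
    have hg : (hφ.memLp_gradient Q.E).toLp ∈ K :=
      (gradSpace Q.E).le_topologicalClosure (hφ.toLp_gradient_mem Q.E)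
    have horth := (Submodule.mem_orthogonal' _ _).1
      (K.sub_starProjection_mem_orthogonal hσ.toLp) _ hg
    rw [inner_sub_left, sub_eq_zero] at horth
    simp only [zero_mul, integral_zero, add_zero]
    rw [← inner_L2Field_eq θ (hφ.memLp_gradient Q.E), ← horth, inner_L2Field_eq,
      integral_inner_congr hσ.coeFn_toLp, ← hσg φ hφ.contDiff_one]
    simp only [real_inner_gradient]
  exact ⟨θ, memVEM_of_green (Lp.memLp θ) hv hw hgreen, normalTrace_of_green hgreen⟩

theorem normalTrace_add {σ τ : L2Field Q.E} {b c : Fin 4 → ℝ}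
    (h₁ : Q.HasNormalTrace σ fun j _ => b j) (h₂ : Q.HasNormalTrace τ fun j _ => c j) :
    Q.HasNormalTrace (σ + τ : L2Field Q.E) fun j _ => b j + c j :=
  (HasNormalTrace.add (Lp.memLp σ) (Lp.memLp τ) h₁ h₂).congr (Lp.coeFn_add σ τ).symm

theorem normalTrace_smul {τ : L2Field Q.E} {c : Fin 4 → ℝ} (a : ℝ)
    (h : Q.HasNormalTrace τ fun j _ => c j) :
    Q.HasNormalTrace (a • τ : L2Field Q.E) fun j _ => a * c j :=
  (h.const_smul a).congr (Lp.coeFn_smul a τ).symm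

theorem normalTrace_sub {σ τ : L2Field Q.E} {b c : Fin 4 → ℝ}
    (h₁ : Q.HasNormalTrace σ fun j _ => b j) (h₂ : Q.HasNormalTrace τ fun j _ => c j) :
    Q.HasNormalTrace (σ - τ : L2Field Q.E) fun j _ => b j - c j := by
  have := normalTrace_add h₁ (normalTrace_smul (-1) h₂)
  simpa only [neg_one_smul, neg_one_mul, ← sub_eq_add_neg] using this

theorem eq_of_normalTrace (h : IsStarBall Q.E x₀ r) {σ τ : L2Field Q.E} (hσ : σ ∈ Q.vemSpace)
    (hτ : τ ∈ Q.vemSpace) {c : Fin 4 → ℝ} (h₁ : Q.HasNormalTrace σ fun j _ => c j)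
    (h₂ : Q.HasNormalTrace τ fun j _ => c j) : σ = τ := by
  refine sub_eq_zero.1 (eq_zero_of_normalTrace h (sub_mem hσ hτ) ?_)
  simpa only [sub_self] using normalTrace_sub h₁ h₂

theorem IsHourglass.unique (h : IsStarBall Q.E x₀ r) {θ θ' : L2Field Q.E}
    (hθ : Q.IsHourglass θ) (hθ' : Q.IsHourglass θ') : θ' = θ :=
  eq_of_normalTrace h hθ'.1 hθ.1 hθ'.2 hθ.2

theorem sum_edgeSign : ∑ j, edgeSign j = 0 := by
  simp only [Fin.sum_univ_four, edgeSign]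
  norm_num

theorem edgeLength_mul_sign (j : Fin 4) :
    Q.edgeLength j * ((-1) ^ ((j : ℕ) + 1) / Q.edgeLength j) = edgeSign j :=
  mul_div_cancel₀ _ (Q.edgeLength_pos j).ne'

theorem IsHourglass.weakDivergence {θ : L2Field Q.E} (hθ : Q.IsHourglass θ) :
    HasWeakDivergence Q.E θ fun _ => 0 := by
  have hV : Q.MemVEM θ := hθ.1
  obtain ⟨δ, hδ⟩ := hV.divergence
  have h1 := hθ.2.divergence_eq (c := fun j => (-1) ^ ((j : ℕ) + 1) / Q.edgeLength j) hδ
  simp only [edgeLength_mul_sign, sum_edgeSign] at h1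
  have h2 : volume.real Q.E ≠ 0 :=
    ENNReal.toReal_ne_zero.2 ⟨Q.volume_E_ne_zero, Q.volume_E_ne_top⟩
  rwa [(mul_eq_zero.1 h1).resolve_right h2] at hδ

theorem IsHourglass.integral_inner_gradient {θ : L2Field Q.E} (hθ : Q.IsHourglass θ)
    {f : Plane → ℝ} (hf : ContDiff ℝ ∞ f) :
    ∫ x in Q.E, inner ℝ (θ x) (gradient f x)
      = ∑ j, edgeSign j * segMean (Q.vertex j) (Q.vertex (j + 1)) f := by
  obtain ⟨φ, hφ, he⟩ := exists_cutoff Q.isBounded_E hf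
  have h1 := hθ.2.green (c := fun j => (-1) ^ ((j : ℕ) + 1) / Q.edgeLength j)
    hθ.weakDivergence hφ
  simp only [edgeLength_mul_sign, zero_mul, add_zero] at h1
  have h2 : ∫ x in Q.E, (inner ℝ (θ x) (gradient f x) : ℝ)
      = ∫ x in Q.E, inner ℝ (θ x) (gradient φ x) :=
    setIntegral_congr_fun Q.isOpen_E.measurableSet fun x hx => by
      simp only [(he x (subset_closure hx)).2]
  rw [h2, h1]
  refine Finset.sum_congr rfl fun j _ => ?_
  rw [segMean_congr fun x hx => (he x (frontier_subset_closure
    (Q.segment_subset_frontier j hx))).1]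

/-- Test with the linear function of gradient `a`: its edge means are its values at the midpoints,
whose alternating sum around a quadrilateral vanishes. -/
theorem IsHourglass.integral_inner_const {θ : L2Field Q.E} (hθ : Q.IsHourglass θ) (a : Plane) :
    ∫ x in Q.E, (inner ℝ (θ x) a : ℝ) = 0 := by
  have hs : ContDiff ℝ ∞ fun x : Plane => (inner ℝ a x : ℝ) := contDiff_const.inner ℝ contDiff_id
  have hg : ∀ x, gradient (fun x : Plane => (inner ℝ a x : ℝ)) x = a := fun x => by
    refine ext_inner_right ℝ fun e => ?_
    have h1 : fderiv ℝ (fun x : Plane => (inner ℝ a x : ℝ)) x = innerSL ℝ a :=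
      ((innerSL ℝ a).hasFDerivAt (x := x)).fderiv
    rw [inner_gradient_real, h1, innerSL_apply_apply]
  have h1 := hθ.integral_inner_gradient hs
  simp only [hg, segMean_inner] at h1
  rw [h1]
  have e : (3 : Fin 4) + 1 = 0 := rfl
  have e' : (2 : Fin 4) + 1 = 3 := rfl
  have e'' : (1 : Fin 4) + 1 = 2 := rfl
  simp only [Fin.sum_univ_four, edgeSign, e, e', e'', zero_add]
  norm_num
  ring

/-- Linear functions do not detect `θ`, so a quadratic one is used. For the two diagonals `a`, `b`
the test function `(a·x)(b·x)` gives `-(|a|²|b|² + (a·b)²) / 6`, which is negative. -/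
theorem IsHourglass.ne_zero {θ : L2Field Q.E} (hθ : Q.IsHourglass θ) : θ ≠ 0 := by
  intro h0
  set a := Q.vertex 2 - Q.vertex 0 with ha
  set b := Q.vertex 3 - Q.vertex 1 with hb
  have ha0 : a ≠ 0 := sub_ne_zero.2 (Q.vertex_injective.ne (by decide))
  have hb0 : b ≠ 0 := sub_ne_zero.2 (Q.vertex_injective.ne (by decide))
  have hs : ContDiff ℝ ∞ fun x : Plane => (inner ℝ a x * inner ℝ b x : ℝ) :=
    (contDiff_const.inner ℝ contDiff_id).mul (contDiff_const.inner ℝ contDiff_id)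
  have h1 := hθ.integral_inner_gradient hs
  have h2 : ∫ x in Q.E, (inner ℝ (θ x)
      (gradient (fun x : Plane => (inner ℝ a x * inner ℝ b x : ℝ)) x) : ℝ) = 0 := by
    rw [h0, integral_inner_congr (Lp.coeFn_zero Plane 2 (volume.restrict Q.E))]
    simp
  have e : (3 : Fin 4) + 1 = 0 := rfl
  have e' : (2 : Fin 4) + 1 = 3 := rfl
  have e'' : (1 : Fin 4) + 1 = 2 := rfl
  have h3 : ∑ j, edgeSign j * segMean (Q.vertex j) (Q.vertex (j + 1))
      (fun x : Plane => (inner ℝ a x * inner ℝ b x : ℝ))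
      = -(inner ℝ a a * inner ℝ b b + inner ℝ a b * inner ℝ b a) / 6 := by
    have k1 : ∀ c : Plane, (inner ℝ c a : ℝ)
        = inner ℝ c (Q.vertex 2) - inner ℝ c (Q.vertex 0) := fun c => inner_sub_right _ _ _
    have k2 : ∀ c : Plane, (inner ℝ c b : ℝ)
        = inner ℝ c (Q.vertex 3) - inner ℝ c (Q.vertex 1) := fun c => inner_sub_right _ _ _
    simp only [segMean_inner_mul_inner, Fin.sum_univ_four, edgeSign, e, e', e'', zero_add, k1, k2]
    norm_num
    ring
  rw [h2, h3, real_inner_comm a b] at h1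
  have pa : 0 < (inner ℝ a a : ℝ) := real_inner_self_pos.2 ha0
  have pb : 0 < (inner ℝ b b : ℝ) := real_inner_self_pos.2 hb0
  nlinarith [mul_pos pa pb, mul_self_nonneg (inner ℝ a b : ℝ)]

/-! ### The decompositions -/

theorem hourglassSpace_eq (h : IsStarBall Q.E x₀ r) {θ : L2Field Q.E} (hθ : Q.IsHourglass θ) :
    Q.hourglassSpace = Submodule.span ℝ {θ} := by
  have : {τ | Q.IsHourglass τ} = {θ} :=
    Set.eq_singleton_iff_unique_mem.2 ⟨hθ, fun _ hτ => hθ.unique h hτ⟩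
  rw [hourglassSpace, this]

/-- Each set of four fluxes is that of a Raviart-Thomas field plus a multiple of the alternating
one. -/
theorem exists_flux_eq (Q : Quadrilateral) (F : Fin 4 → ℝ) : ∃ (a : Plane) (c s : ℝ), ∀ j,
    cross2 (a + c • Q.vertex j) (Q.vertex (j + 1) - Q.vertex j) + s * edgeSign j = F j := by
  set S := ∑ j : Fin 4, cross2 (Q.vertex j) (Q.vertex (j + 1)) with hS
  have hS0 : S ≠ 0 := Q.counterclockwise.ne'
  have e : (3 : Fin 4) + 1 = 0 := rfl
  have e' : (2 : Fin 4) + 1 = 3 := rfl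
  have e'' : (1 : Fin 4) + 1 = 2 := rfl
  -- The total flux fixes `c`, because constant fields and alternating fluxes contribute nothing to
  -- it.
  set c := (∑ j, F j) / S with hc
  set f : Fin 4 → ℝ := fun j => F j - c * cross2 (Q.vertex j) (Q.vertex (j + 1)) with hf
  have hsum : f 0 + f 1 + f 2 + f 3 = 0 := by
    have h1 : ∑ j, f j = 0 := by
      simp only [hf, Finset.sum_sub_distrib, ← Finset.mul_sum]
      rw [← hS, hc, div_mul_cancel₀ _ hS0, sub_self]
    rwa [Fin.sum_univ_four] at h1
  set d₁ := Q.vertex 2 - Q.vertex 0 with hd₁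
  set d₂ := Q.vertex 3 - Q.vertex 1 with hd₂
  have hSd : S = cross2 d₁ d₂ := by
    simp only [hS, Fin.sum_univ_four, cross2, hd₁, hd₂, e, e', e'', zero_add, PiLp.sub_apply]
    ring
  -- Sums of two neighbouring fluxes do not see the alternating part; they are the fluxes of `a`
  -- through the diagonals, which form a basis since `S ≠ 0`.
  set a : Plane := S⁻¹ • ((f 1 + f 2) • d₁ - (f 0 + f 1) • d₂) with ha
  have h1 : cross2 a d₁ = f 0 + f 1 := by
    have : cross2 a d₁ = S⁻¹ * ((f 0 + f 1) * cross2 d₁ d₂) := by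
      simp only [ha, cross2, PiLp.sub_apply, PiLp.smul_apply, smul_eq_mul]; ring
    rw [this, ← hSd]; field_simp
  have h2 : cross2 a d₂ = f 1 + f 2 := by
    have : cross2 a d₂ = S⁻¹ * ((f 1 + f 2) * cross2 d₁ d₂) := by
      simp only [ha, cross2, PiLp.sub_apply, PiLp.smul_apply, smul_eq_mul]; ring
    rw [this, ← hSd]; field_simp
  -- What remains alternates, and its size is read off on edge `0`, whose sign is `-1`.
  refine ⟨a, c, cross2 a (Q.vertex 1 - Q.vertex 0) - f 0, fun j => ?_⟩
  have hsplit : cross2 (a + c • Q.vertex j) (Q.vertex (j + 1) - Q.vertex j)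
      = cross2 a (Q.vertex (j + 1) - Q.vertex j) + (F j - f j) := by
    simp only [hf, cross2, PiLp.sub_apply, PiLp.add_apply, PiLp.smul_apply, smul_eq_mul]; ring
  rw [hsplit]
  simp only [cross2, hd₁, hd₂, PiLp.sub_apply] at h1 h2
  fin_cases j <;> simp only [cross2, edgeSign, PiLp.sub_apply, Fin.mk_zero, Fin.mk_one,
    Fin.reduceFinMk, zero_add, e, e', e'', Fin.isValue]
  · norm_num; ring
  · norm_num; linarith
  · norm_num; linarith
  · norm_num; linarith

/-- `exists_flux_eq` gives a field of the sum with the same fluxes as `τ`, and the fluxes determine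
the field. -/
theorem vemSpace_le (h : IsStarBall Q.E x₀ r) :
    Q.vemSpace ≤ Q.raviartThomas ⊔ Q.hourglassSpace := by
  intro τ hτ
  obtain ⟨θ, hθ⟩ := exists_isHourglass h
  have hV : Q.MemVEM τ := hτ
  obtain ⟨b, hb⟩ := hV.normalTrace
  obtain ⟨a, c, s, hflux⟩ := Q.exists_flux_eq fun j => Q.edgeLength j * b j
  let ρ : L2Field Q.E := (Q.memLp_raviartThomas a c).toLp
  have hρe : ρ =ᵐ[volume.restrict Q.E] fun x => a + c • x :=
    (Q.memLp_raviartThomas a c).coeFn_toLp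
  have hρ : ρ ∈ Q.raviartThomas := ⟨a, c, hρe⟩
  have hρt := (normalTrace_of_green fun _ hφ => green_raviartThomas h a c hφ).congr hρe.symm
  have hsum := normalTrace_add hρt (normalTrace_smul s (τ := θ)
    (c := fun j => (-1) ^ ((j : ℕ) + 1) / Q.edgeLength j) hθ.2)
  have hb' : (fun (j : Fin 4) (_ : Plane) => b j) = fun j _ =>
      cross2 (a + c • Q.vertex j) (Q.vertex (j + 1) - Q.vertex j) / Q.edgeLength j
        + s * ((-1) ^ ((j : ℕ) + 1) / Q.edgeLength j) := by
    funext j _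
    have hl := (Q.edgeLength_pos j).ne'
    have := hflux j
    rw [edgeSign] at this
    field_simp
    linarith
  rw [hb'] at hb
  rw [eq_of_normalTrace h hτ
    (add_mem (raviartThomas_le h hρ) (Submodule.smul_mem _ s hθ.1)) hb hsum]
  exact Submodule.add_mem_sup hρ (Submodule.smul_mem _ s (Submodule.subset_span hθ))

theorem hourglassSpace_le : Q.hourglassSpace ≤ Q.vemDivFree :=
  Submodule.span_le.2 fun _ hθ => ⟨hθ.1, hθ.weakDivergence⟩

theorem constFields_le (h : IsStarBall Q.E x₀ r) : Q.constFields ≤ Q.vemDivFree := by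
  rintro τ ⟨a, ha⟩
  have ha' : τ =ᵐ[volume.restrict Q.E] fun x => a + (0 : ℝ) • x := by simpa using ha
  refine ⟨raviartThomas_le h ⟨a, 0, ha'⟩, ?_⟩
  have := (weakDivergence_raviartThomas h a 0).congr ha'.symm
  simpa using this

theorem mem_constFields_of_divFree (h : IsStarBall Q.E x₀ r) {τ : L2Field Q.E}
    (hτ : τ ∈ Q.raviartThomas) (hd : τ ∈ Q.vemDivFree) : τ ∈ Q.constFields := by
  obtain ⟨a, c, ha⟩ := hτ
  have h0 := weakDivergence_const_unique
    ((weakDivergence_raviartThomas h a c).congr ha.symm) hd.2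
  have hc : c = 0 := by linarith
  exact ⟨a, by simpa [hc] using ha⟩

theorem constFields_isOrtho : Q.constFields ⟂ Q.hourglassSpace := by
  rw [Submodule.isOrtho_comm, Submodule.IsOrtho, hourglassSpace, Submodule.span_le]
  intro θ hθ
  rw [SetLike.mem_coe, Submodule.mem_orthogonal']
  rintro τ ⟨a, ha⟩
  rw [L2.inner_def]
  refine Eq.trans (integral_congr_ae ?_) (hθ.integral_inner_const a)
  filter_upwards [ha] with x hx
  rw [hx]

end Quadrilateral

/-! ### The theorem -/

theorem mainTheorem5 (Q : Quadrilateral) (γ : ℝ) (hγ : 0 < γ) (hQ : Q.ShapeRegular γ) :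
    -- the hourglass function exists and is unique, and it spans a line
    (∃! θ : L2Field Q.E, Q.IsHourglass θ) ∧
    Module.finrank ℝ Q.hourglassSpace = 1 ∧
    -- `Σ_h(E) = RT_0(E) ⊕ HG(E)`
    (Disjoint Q.raviartThomas Q.hourglassSpace ∧
      Q.raviartThomas ⊔ Q.hourglassSpace = Q.vemSpace) ∧
    -- the divergence-free subspace is the `L²`-orthogonal sum `(P_0(E))² ⊕ HG(E)`
    (Disjoint Q.constFields Q.hourglassSpace ∧
      Q.constFields ⊔ Q.hourglassSpace = Q.vemDivFree ∧
      Q.constFields ⟂ Q.hourglassSpace) := by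
  obtain ⟨x₀, r, h⟩ := hQ.exists_isStarBall hγ
  obtain ⟨θ, hθ⟩ := Quadrilateral.exists_isHourglass h
  have hort := Q.constFields_isOrtho
  have hdisj := hort.disjoint
  refine ⟨⟨θ, hθ, fun _ hθ' => hθ.unique h hθ'⟩, ?_, ⟨?_, ?_⟩, hdisj, ?_, hort⟩
  · rw [Quadrilateral.hourglassSpace_eq h hθ]
    exact finrank_span_singleton hθ.ne_zero
  -- A common element is divergence-free, hence a constant field, and orthogonality finishes.
  · rw [Submodule.disjoint_def] at hdisj ⊢
    exact fun τ h1 h2 => hdisj τ (Quadrilateral.mem_constFields_of_divFree h h1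
      (Quadrilateral.hourglassSpace_le h2)) h2
  · exact le_antisymm (sup_le (Quadrilateral.raviartThomas_le h)
      (Quadrilateral.hourglassSpace_le.trans fun _ hτ => hτ.1)) (Quadrilateral.vemSpace_le h)
  · refine le_antisymm (sup_le (Quadrilateral.constFields_le h)
      Quadrilateral.hourglassSpace_le) fun τ hτ => ?_
    obtain ⟨ρ, hρ, ζ, hζ, rfl⟩ := Submodule.mem_sup.1 (Quadrilateral.vemSpace_le h hτ.1)
    -- Both `τ` and its hourglass part are divergence-free, so the Raviart-Thomas part is too, hence
    -- constant.
    have hρd : ρ ∈ Q.vemDivFree := by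
      simpa using sub_mem hτ (Quadrilateral.hourglassSpace_le hζ)
    exact Submodule.add_mem_sup (Quadrilateral.mem_constFields_of_divFree h hρ hρd) hζ

end
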